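/- For $n\ge 1$, an $n$-graph is a finite nonempty directed graph $G=(V,E)$, $E\subseteq V\times V$ (self-loops allowed), together with sets $U_1,\dots,U_n\subseteq V$ of coloured vertices. A local bidirectional ReLU graph neural network (GNN) on $n$-graphs consists of a number of layers $L\ge 1$, dimensions $d_0=n,\ d_1,\dots,d_L\ge 1$, and, for each layer $1\le \ell\le L$, rational matrices $C^{(\ell)},A^{(\ell)}_{\mathrm{out}},A^{(\ell)}_{\mathrm{in}}\in\mathbb{Q}^{d_\ell\times d_{\ell-1}}$ and a bias $b^{(\ell)}\in\mathbb{Q}^{d_\ell}$ (there is no global readout term). On an $n$-graph $G$ it computes $\xi^{(0)}(v)\in\{0,1\}^n$, with $\xi^{(0)}_i(v)=1$ iff $v\in U_i$, and $$\xi^{(\ell)}(v)=\mathrm{ReLU}\Big(C^{(\ell)}\xi^{(\ell-1)}(v)+A^{(\ell)}_{\mathrm{out}}\sum_{u:(v,u)\in E}\xi^{(\ell-1)}(u)+A^{(\ell)}_{\mathrm{in}}\sum_{u:(u,v)\in E}\xi^{(\ell-1)}(u)+b^{(\ell)}\Big),$$ where $\mathrm{ReLU}(x)=\max(x,0)$ is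 applied entrywise. It accepts $(G,v)$ if $\xi^{(L)}_1(v)\ge 1/2$. It is universally satisfiable if there is an $n$-graph $G$ such that it accepts $(G,v)$ for every vertex $v$ of $G$. **Theorem.** The universal satisfiability problem of local bidirectional ReLU GNNs is undecidable: there is no algorithm that, given (the dimensions and rational coefficients of) a local bidirectional ReLU GNN, decides whether it is universally satisfiable. -/

import Mathlib

/-- An `n`-graph: a finite nonempty directed graph (self-loops allowed, no parallel edges)
with `n` vertex colours; a vertex may have any set of colours. -/
structure ColoredGraph (n : ℕ) where
  V : Type
  [fintypeV : Fintype V]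
  [nonemptyV : Nonempty V]
  E : Set (V × V)
  U : Fin n → Set V

attribute [instance] ColoredGraph.fintypeV ColoredGraph.nonemptyV

open Classical in
/-- Out-neighbours of a vertex. -/
noncomputable def ColoredGraph.outNbr {n : ℕ} (G : ColoredGraph n) (v : G.V) : Finset G.V :=
  Finset.univ.filter fun u => (v, u) ∈ G.E

open Classical in
/-- In-neighbours of a vertex. -/
noncomputable def ColoredGraph.inNbr {n : ℕ} (G : ColoredGraph n) (v : G.V) : Finset G.V :=
  Finset.univ.filter fun u => (u, v) ∈ G.E

/-- An aggregate-combine graph neural network with rational coefficients. Layer `ℓ : Fin numLayers`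
maps feature vectors of dimension `dim ℓ.castSucc` to feature vectors of dimension `dim ℓ.succ`.
The network is an `n`-GNN for `n = dim 0`. -/
structure GNN where
  numLayers : ℕ
  numLayers_pos : 0 < numLayers
  dim : Fin (numLayers + 1) → ℕ
  dim_pos : ∀ ℓ, 0 < dim ℓ
  act : Fin numLayers → ℚ → ℚ
  coefC : (ℓ : Fin numLayers) → Matrix (Fin (dim ℓ.succ)) (Fin (dim ℓ.castSucc)) ℚ
  coefOut : (ℓ : Fin numLayers) → Matrix (Fin (dim ℓ.succ)) (Fin (dim ℓ.castSucc)) ℚ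
  coefIn : (ℓ : Fin numLayers) → Matrix (Fin (dim ℓ.succ)) (Fin (dim ℓ.castSucc)) ℚ
  coefR : (ℓ : Fin numLayers) → Matrix (Fin (dim ℓ.succ)) (Fin (dim ℓ.castSucc)) ℚ
  bias : (ℓ : Fin numLayers) → Fin (dim ℓ.succ) → ℚ

/-- The ReLU activation function. -/
def relu (x : ℚ) : ℚ := if 0 ≤ x then x else 0

namespace GNN

/-- The number of vertex colours of the input graphs. -/
abbrev numColors (A : GNN) : ℕ := A.dim 0

open Classical in
/-- The `0`-features: indicators of the colours. -/
noncomputable def inputFeature (A : GNN) (G : ColoredGraph A.numColors) (v : G.V) :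
    Fin (A.dim 0) → ℚ :=
  fun i => if v ∈ G.U i then 1 else 0

open scoped Matrix in
/-- One layer of the computation: from the features `ξ` before layer `ℓ` to those after it. -/
noncomputable def layerStep (A : GNN) (G : ColoredGraph A.numColors) (ℓ : Fin A.numLayers)
    (ξ : G.V → Fin (A.dim ℓ.castSucc) → ℚ) (v : G.V) : Fin (A.dim ℓ.succ) → ℚ :=
  fun i => A.act ℓ
    ((A.coefC ℓ *ᵥ ξ v
      + A.coefOut ℓ *ᵥ (∑ u ∈ G.outNbr v, ξ u)
      + A.coefIn ℓ *ᵥ (∑ u ∈ G.inNbr v, ξ u)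
      + A.coefR ℓ *ᵥ (∑ u, ξ u)
      + A.bias ℓ) i)

/-- The derived feature functions, for `ℓ = 0, …, numLayers`. -/
noncomputable def feature (A : GNN) (G : ColoredGraph A.numColors) (ℓ : Fin (A.numLayers + 1)) :
    G.V → Fin (A.dim ℓ) → ℚ :=
  Fin.induction (motive := fun ℓ => G.V → Fin (A.dim ℓ) → ℚ)
    (A.inputFeature G) (fun ℓ ξ => A.layerStep G ℓ ξ) ℓ

/-- Acceptance: the first entry of the last feature vector is at least `1/2`. -/
def Accepts (A : GNN) (G : ColoredGraph A.numColors) (v : G.V) : Prop :=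
  1 / 2 ≤ A.feature G (Fin.last A.numLayers) v ⟨0, A.dim_pos _⟩

/-- Some graph has all its vertices accepted. -/
def UniversallySatisfiable (A : GNN) : Prop :=
  ∃ G : ColoredGraph A.numColors, ∀ v : G.V, A.Accepts G v

/-- Local: no global readout. -/
def IsLocal (A : GNN) : Prop := ∀ ℓ, A.coefR ℓ = 0

/-- Every activation function is ReLU. -/
def IsReLU (A : GNN) : Prop := ∀ ℓ, A.act ℓ = relu

/-! ### Finite descriptions of networks -/

/-- Rationals are written as (numerator, denominator) in lowest terms. -/
abbrev RatCode : Type := ℤ × ℕ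

/-- A matrix is written as the list of its rows. -/
abbrev MatrixCode : Type := List (List RatCode)

/-- A layer is written as the tuple of its four matrices and its bias vector. -/
abbrev LayerCode : Type := MatrixCode × MatrixCode × MatrixCode × MatrixCode × List RatCode

/-- A network is written as the list of its dimensions together with the list of its layers. -/
abbrev Code : Type := List ℕ × List LayerCode

def ratCode (q : ℚ) : RatCode := (q.num, q.den)

def vecCode {m : ℕ} (b : Fin m → ℚ) : List RatCode := List.ofFn fun i => ratCode (b i)

def matrixCode {m k : ℕ} (M : Matrix (Fin m) (Fin k) ℚ) : MatrixCode :=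
  List.ofFn fun i => vecCode (M i)

def layerCode (A : GNN) (ℓ : Fin A.numLayers) : LayerCode :=
  (matrixCode (A.coefC ℓ), matrixCode (A.coefOut ℓ), matrixCode (A.coefIn ℓ),
    matrixCode (A.coefR ℓ), vecCode (A.bias ℓ))

/-- The description of a network given to an algorithm. The activation functions are not
recorded: for a ReLU network there is nothing to record. -/
def code (A : GNN) : Code := (List.ofFn A.dim, List.ofFn A.layerCode)

theorem ratCode_injective : Function.Injective ratCode := by
  intro p q h
  simp only [ratCode, Prod.mk.injEq] at h
  exact Rat.ext h.1 h.2

theorem vecCode_injective {m : ℕ} : Function.Injective (vecCode (m := m)) := by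
  intro b c h
  funext i
  exact ratCode_injective (congrFun (List.ofFn_injective h) i)

theorem matrixCode_injective {m k : ℕ} : Function.Injective (matrixCode (m := m) (k := k)) := by
  intro M N h
  funext i
  exact vecCode_injective (congrFun (List.ofFn_injective h) i)

/-- A ReLU network is determined by its description. -/
theorem code_injOn : Set.InjOn code {A | A.IsReLU} := by
  rintro ⟨L, hL, d, hd, a, C, O, I, R, b⟩ ha ⟨L', hL', d', hd', a', C', O', I', R', b'⟩ ha' h
  simp only [code, Prod.mk.injEq] at h
  obtain ⟨h1, h2⟩ := h
  have hlen : L = L' := by simpa using congrArg List.length h2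
  subst hlen
  obtain rfl : d = d' := List.ofFn_injective h1
  have h3 := fun ℓ => congrFun (List.ofFn_injective h2) ℓ
  simp only [layerCode, Prod.mk.injEq] at h3
  obtain rfl : a = a' := funext fun ℓ => (ha ℓ).trans (ha' ℓ).symm
  obtain rfl : C = C' := funext fun ℓ => matrixCode_injective (h3 ℓ).1
  obtain rfl : O = O' := funext fun ℓ => matrixCode_injective (h3 ℓ).2.1
  obtain rfl : I = I' := funext fun ℓ => matrixCode_injective (h3 ℓ).2.2.1
  obtain rfl : R = R' := funext fun ℓ => matrixCode_injective (h3 ℓ).2.2.2.1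
  obtain rfl : b = b' := funext fun ℓ => vecCode_injective (h3 ℓ).2.2.2.2
  rfl

end GNN

/-! The halting problem is reduced to universal satisfiability through three translations; the
halting instance enters only as one number `n`, which ends up as a bias.

Computations become derivations. A fixed program of Horn rules with linear constraints over `ℕ`
interprets `Nat.Partrec.Code`. Linear constraints suffice: squares arise from (a+1)² = a² + 2a + 1,
Cantor pairs are linear in squares, and the number of a compound code is linear in a Cantor pair of
numbers or in the number of its subcode. The goal is derivable for the parameter `n` iff the code
numbered `n` halts on 0 (`derivable_goal_iff`).

Derivations become finite graphs (`exists_derivable_of_graph`, `exists_graph_of_derivable`). A claim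
vertex is a rule application and stores its numbers in unary, as numbers of unit out-neighbours. It
reads its own numbers as counts of out-neighbours and those of a premise as counts of two-step
walks. Units carry the premise slot of their owner, and a claim has at most one child per slot, so
walks ending in units of one slot count the numbers of one child. Units and subderivations may be
shared, because only outgoing counts matter. Each claim also stores a depth that grows along edges
between claims. In a finite graph this rules out cycles, so derivability follows by induction; and
since every claim that does not conclude the goal needs a claim as in-neighbour, a claim of least
depth concludes the goal. Local conditions thus force a global fact without any readout.

Local constraints become a network (`exists_checking_network`). The constraints are integer linear
inequalities in neighbour and walk counts, possibly restricted to one colour, and six ReLU layers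
test them all. -/

/-! ### Networks whose layers all have the same index type -/

/-- The coefficients of a layer without readout whose features are indexed by `X`. -/
structure LayerData (X : Type) where
  C : X → X → ℚ
  O : X → X → ℚ
  I : X → X → ℚ
  b : X → ℚ

namespace LayerData

variable {X : Type} [Fintype X]

open Classical in
/-- One ReLU layer on the graph with edge relation `E`. -/
noncomputable def step {V : Type} [Fintype V] (l : LayerData X) (E : V → V → Prop) (ξ : V → X → ℚ) (v : V) (x : X) : ℚ :=
  relu (∑ y, l.C x y * ξ v y + ∑ y, l.O x y * (∑ u with E v u, ξ u y)
    + ∑ y, l.I x y * (∑ u with E u v, ξ u y) + l.b x)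

/-- The features after `i` layers. -/
noncomputable def run {V : Type} [Fintype V] (l : ℕ → LayerData X) (E : V → V → Prop) (ξ : V → X → ℚ) :
    ℕ → V → X → ℚ
  | 0 => ξ
  | i + 1 => (l i).step E (run l E ξ i)

/-- The local ReLU network with the first `L` of the given layers. -/
noncomputable def toGNN [Nonempty X] (L : ℕ) (hL : 0 < L) (l : ℕ → LayerData X) : GNN where
  numLayers := L
  numLayers_pos := hL
  dim _ := Fintype.card X
  dim_pos _ := Fintype.card_pos
  act _ := relu
  coefC i j k := (l i).C ((Fintype.equivFin X).symm j) ((Fintype.equivFin X).symm k)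
  coefOut i j k := (l i).O ((Fintype.equivFin X).symm j) ((Fintype.equivFin X).symm k)
  coefIn i j k := (l i).I ((Fintype.equivFin X).symm j) ((Fintype.equivFin X).symm k)
  coefR _ := 0
  bias i j := (l i).b ((Fintype.equivFin X).symm j)

theorem layerStep_toGNN [Nonempty X] (L : ℕ) (hL : 0 < L) (l : ℕ → LayerData X)
    (G : ColoredGraph (Fintype.card X)) (i : Fin L) (ξ : G.V → X → ℚ) (v : G.V)
    (j : Fin (Fintype.card X)) :
    (toGNN L hL l).layerStep G i
        (fun (v : G.V) (j : Fin (Fintype.card X)) => ξ v ((Fintype.equivFin X).symm j)) v j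
      = (l i).step (fun v u => (v, u) ∈ G.E) ξ v ((Fintype.equivFin X).symm j) := by
  set e := (Fintype.equivFin X).symm with he
  change relu (∑ k, (l i).C (e j) (e k) * ξ v (e k)
      + ∑ k, (l i).O (e j) (e k) * (∑ u ∈ G.outNbr v, fun j => ξ u (e j)) k
      + ∑ k, (l i).I (e j) (e k) * (∑ u ∈ G.inNbr v, fun j => ξ u (e j)) k
      + ∑ k, 0 * (∑ u, fun j => ξ u (e j)) k + (l i).b (e j)) = _
  simp only [Finset.sum_apply, zero_mul, Finset.sum_const_zero, add_zero, step, ← e.sum_comp,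
    ColoredGraph.outNbr, ColoredGraph.inNbr]

open Classical in
theorem feature_toGNN [Nonempty X] (L : ℕ) (hL : 0 < L) (l : ℕ → LayerData X)
    (G : ColoredGraph (Fintype.card X)) (i : Fin (L + 1)) :
    (toGNN L hL l).feature G i = fun (v : G.V) (j : Fin (Fintype.card X)) =>
      run l (fun v u => (v, u) ∈ G.E)
        (fun v x => if v ∈ G.U (Fintype.equivFin X x) then 1 else 0) i v
        ((Fintype.equivFin X).symm j) := by
  induction i using Fin.induction with
  | zero =>
    refine funext fun (v : G.V) => funext fun (j : Fin (Fintype.card X)) => ?_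
    refine Eq.trans (b := if v ∈ G.U j then (1 : ℚ) else 0) rfl ?_
    simp [run]
  | succ i ih =>
    refine Eq.trans (b := (toGNN L hL l).layerStep G i ((toGNN L hL l).feature G i.castSucc)) rfl ?_
    refine (congrArg ((toGNN L hL l).layerStep G i) ih).trans ?_
    exact funext fun v => funext fun j => layerStep_toGNN L hL l G i _ v j

open Classical in
-- Acceptance reads the coordinate numbered 0, and `Fintype.equivFin` leaves open which element of
-- `X` that is. The hypothesis `hrow` makes the choice immaterial. Every element of `X` counts as an
-- input colour here.
theorem universallySatisfiable_toGNN [Nonempty X] (L : ℕ) (hL : 0 < L) (l : ℕ → LayerData X)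
    (hrow : ∀ (V : Type) [Fintype V] (E : V → V → Prop) (ξ : V → X → ℚ) v x y,
      run l E ξ L v x = run l E ξ L v y) :
    (toGNN L hL l).UniversallySatisfiable ↔
      ∃ (V : Type) (_ : Fintype V) (_ : Nonempty V) (E : V → V → Prop) (c : V → X → Prop),
        ∀ v x, 1 / 2 ≤ run l E (fun v x => if c v x then 1 else 0) L v x := by
  constructor
  · rintro ⟨G, hG⟩
    refine ⟨G.V, G.fintypeV, G.nonemptyV, fun v u => (v, u) ∈ G.E,
      fun v x => v ∈ G.U (Fintype.equivFin X x), fun v x => ?_⟩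
    have h : (1 / 2 : ℚ) ≤ _ :=
      (hG v).trans_eq (congrFun (congrFun (feature_toGNN L hL l G (Fin.last L)) v) _)
    rw [hrow _ _ _ _ x]
    exact h
  · rintro ⟨V, hV, hV', E, c, h⟩
    let G : ColoredGraph (Fintype.card X) :=
      ⟨V, {p | E p.1 p.2}, fun i => {v | c v ((Fintype.equivFin X).symm i)}⟩
    refine ⟨G, fun v => ?_⟩
    refine le_of_le_of_eq ?_
      (congrFun (congrFun (feature_toGNN L hL l G (Fin.last L)) v) _).symm
    simpa [G] using h v _

theorem computable_ratCode_natCast : Computable fun n : ℕ => GNN.ratCode (n : ℚ) := by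
  have h : Primrec fun n : ℕ => (n : ℤ) := by
    -- The encoding of `ℤ` sends a natural number `n` to `2 * n`.
    refine Primrec.encode_iff.1 ((Primrec.nat_mul.comp (.const 2) .id).of_eq fun n => ?_)
    rfl
  exact ((Primrec.pair h (.const 1)).of_eq fun n => by simp [GNN.ratCode]).to_comp

/-- If only the biases depend on a parameter, and each of them is computable, then the description
of the network is computable. -/
theorem computable_code_toGNN [Nonempty X] (L : ℕ) (hL : 0 < L) (l : ℕ → ℕ → LayerData X)
    (hC : ∀ n i, (l n i).C = (l 0 i).C) (hO : ∀ n i, (l n i).O = (l 0 i).O)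
    (hI : ∀ n i, (l n i).I = (l 0 i).I)
    (hb : ∀ i x, Computable fun n => GNN.ratCode ((l n i).b x)) :
    Computable fun n => (toGNN L hL (l n)).code := by
  refine Computable.pair (.const (List.ofFn fun _ : Fin (L + 1) => Fintype.card X))
    (Computable.list_ofFn fun i => ?_)
  let code : (X → X → ℚ) → GNN.MatrixCode := fun M =>
    GNN.matrixCode fun j k : Fin (Fintype.card X) =>
      M ((Fintype.equivFin X).symm j) ((Fintype.equivFin X).symm k)
  refine (Computable.pair (.const (code (l 0 i).C)) (Computable.pair (.const (code (l 0 i).O))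
    (Computable.pair (.const (code (l 0 i).I)) (Computable.pair (.const (code 0))
      (Computable.list_ofFn fun j => hb i ((Fintype.equivFin X).symm j)))))).of_eq fun n => ?_
  rw [← hC n, ← hO n, ← hI n]
  rfl

end LayerData

/-! ### Networks that check local linear constraints -/

/-- The quantities attached to a vertex of a graph with colours `K` that local constraints speak
about: membership in a colour, the numbers of out- and in-neighbours of a colour, the number of
two-step out-walks that end in a colour, the number `1`, and a global parameter. -/
inductive Atom (K : Type) where
  | own (k : K)
  | outc (k : K)
  | inc (k : K)
  | walk (k : K)
  | one
  | par
  deriving Fintype, DecidableEq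

namespace Atom

variable {K V : Type} [Fintype V]

open Classical in
/-- The number of out-neighbours of colour `k`. -/
noncomputable def outCount (E : V → V → Prop) (c : V → K → Prop) (v : V) (k : K) : ℕ :=
  Finset.card {u | E v u ∧ c u k}

theorem outCount_eq_card (E : V → V → Prop) (c : V → K → Prop) (v : V) (k : K) :
    outCount E c v k = Nat.card {u // E v u ∧ c u k} := by
  classical
  rw [Nat.card_eq_fintype_card, Fintype.card_subtype]
  exact congrArg Finset.card (Finset.filter_congr_decidable ..)

open Classical in
/-- The value of an atom at a vertex. -/
noncomputable def val (n : ℕ) (E : V → V → Prop) (c : V → K → Prop) (v : V) : Atom K → ℕ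
  | own k => if c v k then 1 else 0
  | outc k => outCount E c v k
  | inc k => Finset.card {u | E u v ∧ c u k}
  | walk k => ∑ u with E v u, outCount E c u k
  | one => 1
  | par => n

/-- The value of a linear form in the atoms. -/
noncomputable def eval [Fintype K] (n : ℕ) (E : V → V → Prop) (c : V → K → Prop) (v : V) :
    (Atom K → ℤ) →+ ℤ where
  toFun f := ∑ a, f a * val n E c v a
  map_zero' := by simp
  map_add' f g := by simp [add_mul, Finset.sum_add_distrib]

end Atom

theorem relu_of_nonneg {x : ℚ} (h : 0 ≤ x) : relu x = x := if_pos h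

theorem relu_eq_max (x : ℚ) : relu x = max 0 x := by
  unfold relu
  split_ifs with h
  · exact (max_eq_right h).symm
  · exact (max_eq_left (le_of_not_ge h)).symm

/-! ### The six-layer network that tests guarded linear inequalities. -/

section checker

variable {K M : Type} [Fintype K] [DecidableEq K] [Fintype M] [DecidableEq M]

open LayerData

/-- The first layer of the checking network: it counts neighbours. -/
def countLayer (n : ℕ) : LayerData (Atom K ⊕ M) where
  C
    | .inl (.own k) => Pi.single (.inl (.own k)) 1
    | _ => 0
  O
    | .inl (.outc k) => Pi.single (.inl (.own k)) 1
    | _ => 0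
  I
    | .inl (.inc k) => Pi.single (.inl (.own k)) 1
    | _ => 0
  b
    | .inl .one => 1
    | .inl .par => n
    | _ => 0

/-- The second layer: it counts two-step walks. -/
def walkLayer : LayerData (Atom K ⊕ M) where
  C
    | .inl (.walk _) => 0
    | .inl a => Pi.single (.inl a) 1
    | _ => 0
  O
    | .inl (.walk k) => Pi.single (.inl (.outc k)) 1
    | _ => 0
  I := 0
  b := 0

/-- A layer that keeps the atoms and combines locally. -/
def keepLayer (C : M → Atom K ⊕ M → ℚ) (b : ℚ) : LayerData (Atom K ⊕ M) where
  C := Sum.elim (fun a => Pi.single (.inl a) 1) C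
  O := 0
  I := 0
  b := Sum.elim 0 fun _ => b

/-- The fifth layer: it reports the violated constraints. -/
def guardLayer (guard : M → Option K) : LayerData (Atom K ⊕ M) where
  C := Sum.elim 0 fun m =>
    Pi.single (.inl ((guard m).elim .one .own)) 1 - Pi.single (.inr m) 1
  O := 0
  I := 0
  b := 0

/-- The last layer: it accepts if no constraint is violated. -/
def acceptLayer : LayerData (Atom K ⊕ M) where
  C := fun _ _ => -1
  O := 0
  I := 0
  b := 1

/-- The layers of the checking network. -/
def checkLayers (guard : M → Option K) (form : M → Atom K → ℤ) (n : ℕ) :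
    ℕ → LayerData (Atom K ⊕ M)
  | 0 => countLayer n
  | 1 => walkLayer
  | 2 => keepLayer (fun m => Sum.elim (fun a => -form m a) 0) 0
  | 3 => keepLayer (fun m => -Pi.single (.inr m) 1) 1
  | 4 => guardLayer guard
  | _ => acceptLayer

variable {V : Type} [Fintype V] (E : V → V → Prop) (n : ℕ)

/-- Only the `own` entries of the input are read, so the colours attached to all other coordinates
have no influence. The walk entries stay 0 until the neighbour counts are available. -/
theorem step_countLayer (ξ : V → Atom K ⊕ M → ℚ) (c : V → K → Prop)
    (h : ∀ v k, ξ v (.inl (.own k)) = Atom.val n E c v (.own k)) (v : V) (a : Atom K) :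
    (countLayer n).step E ξ v (.inl a)
      = if (∃ k, a = .walk k) then 0 else (Atom.val n E c v a : ℚ) := by
  rw [step]
  split_ifs with hw
  · obtain ⟨k, rfl⟩ := hw
    simp [countLayer, relu]
  · rw [← relu_of_nonneg (Nat.cast_nonneg (Atom.val n E c v a))]
    cases a
    case walk k => exact absurd ⟨k, rfl⟩ hw
    all_goals simp [countLayer, Pi.single_apply, h, Atom.val, Atom.outCount, Finset.filter_filter]

theorem step_walkLayer (ξ : V → Atom K ⊕ M → ℚ) (c : V → K → Prop)
    (h : ∀ v a, ξ v (.inl a) = if (∃ k, a = .walk k) then 0 else (Atom.val n E c v a : ℚ))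
    (v : V) (a : Atom K) :
    walkLayer.step E ξ v (.inl a) = Atom.val n E c v a := by
  rw [step, ← relu_of_nonneg (Nat.cast_nonneg (Atom.val n E c v a))]
  cases a <;> simp [walkLayer, Pi.single_apply, h, Atom.val]

theorem step_keepLayer_inl (ξ : V → Atom K ⊕ M → ℚ) (C : M → Atom K ⊕ M → ℚ) (b : ℚ)
    (v : V) (a : Atom K) :
    (keepLayer C b).step E ξ v (.inl a) = relu (ξ v (.inl a)) := by
  simp [step, keepLayer, Pi.single_apply, -Fintype.sum_sum_type]

theorem step_keepLayer_inr (ξ : V → Atom K ⊕ M → ℚ) (C : M → Atom K ⊕ M → ℚ) (b : ℚ)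
    (v : V) (m : M) :
    (keepLayer C b).step E ξ v (.inr m) = relu (∑ x, C m x * ξ v x + b) := by
  simp [step, keepLayer, -Fintype.sum_sum_type]

theorem step_guardLayer_inl (guard : M → Option K) (ξ : V → Atom K ⊕ M → ℚ) (v : V) (a : Atom K) :
    (guardLayer guard).step E ξ v (.inl a) = 0 := by
  simp [step, guardLayer, relu]

theorem step_guardLayer_inr (guard : M → Option K) (ξ : V → Atom K ⊕ M → ℚ) (v : V) (m : M) :
    (guardLayer guard).step E ξ v (.inr m)
      = relu (ξ v (.inl ((guard m).elim .one .own)) - ξ v (.inr m)) := by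
  simp [step, guardLayer, Pi.single_apply, -Fintype.sum_sum_type, sub_mul]

omit [DecidableEq K] [DecidableEq M] in
theorem step_acceptLayer (ξ : V → Atom K ⊕ M → ℚ) (v : V) (x : Atom K ⊕ M) :
    acceptLayer.step E ξ v x = relu (1 - ∑ y, ξ v y) := by
  simp [step, acceptLayer, -Fintype.sum_sum_type, sub_eq_neg_add]

theorem run_checkLayers_two (guard : M → Option K) (form : M → Atom K → ℤ)
    (ξ : V → Atom K ⊕ M → ℚ) (c : V → K → Prop)
    (h : ∀ v k, ξ v (.inl (.own k)) = Atom.val n E c v (.own k)) (v : V) (a : Atom K) :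
    run (checkLayers guard form n) E ξ 2 v (.inl a) = Atom.val n E c v a :=
  step_walkLayer E n _ c (fun v a => step_countLayer E n ξ c h v a) v a

open Classical in
-- The atoms are nonnegative, so ReLU passes them on unchanged. With `f` the value of the form,
-- layers three and four compute `relu (-f)` and then `relu (1 - relu (-f))`, the indicator of `0 ≤
-- f`. Subtracting it from the indicator of the guard leaves the indicator of a violation.
theorem run_checkLayers_five (guard : M → Option K) (form : M → Atom K → ℤ)
    (ξ : V → Atom K ⊕ M → ℚ) (c : V → K → Prop)
    (h : ∀ v k, ξ v (.inl (.own k)) = Atom.val n E c v (.own k)) (v : V) (m : M) :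
    run (checkLayers guard form n) E ξ 5 v (.inr m) =
      if (∀ k ∈ guard m, c v k) → 0 ≤ Atom.eval n E c v (form m) then 0 else 1 := by
  have h2 := run_checkLayers_two E n guard form ξ c h
  have h3 : ∀ v a, run (checkLayers guard form n) E ξ 3 v (.inl a) = Atom.val n E c v a :=
    fun v a => by
      rw [← relu_of_nonneg (Nat.cast_nonneg (Atom.val n E c v a)), ← h2]
      exact step_keepLayer_inl E _ _ _ v a
  have h4 : ∀ v a, run (checkLayers guard form n) E ξ 4 v (.inl a) = Atom.val n E c v a :=
    fun v a => by
      rw [← relu_of_nonneg (Nat.cast_nonneg (Atom.val n E c v a)), ← h3]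
      exact step_keepLayer_inl E _ _ _ v a
  have k3 : run (checkLayers guard form n) E ξ 3 v (.inr m)
      = relu (-(Atom.eval n E c v (form m) : ℤ)) := by
    refine (step_keepLayer_inr E _ _ _ v m).trans ?_
    simp [h2, Atom.eval]
  have k4 : run (checkLayers guard form n) E ξ 4 v (.inr m)
      = if 0 ≤ Atom.eval n E c v (form m) then 1 else 0 := by
    refine (step_keepLayer_inr E _ _ _ v m).trans ?_
    simp only [Pi.neg_apply, Pi.single_apply, neg_mul, ite_mul, one_mul, zero_mul,
      Finset.sum_neg_distrib, Finset.sum_ite_eq', Finset.mem_univ, if_true, k3]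
    split_ifs with hz
    · have : (0 : ℚ) ≤ Atom.eval n E c v (form m) := by exact_mod_cast hz
      rw [relu_eq_max (-_), max_eq_left (by linarith)]
      norm_num [relu]
    -- Integrality: a negative value is at most -1, which suffices to bring `1 - relu (-f)` down to
    -- 0 or below.
    · have : (Atom.eval n E c v (form m) : ℚ) ≤ -1 := by
        exact_mod_cast Int.le_sub_one_of_lt (not_le.1 hz)
      rw [relu_of_nonneg (x := -_) (by linarith), relu_eq_max, max_eq_left (by linarith)]
  have k5 : run (checkLayers guard form n) E ξ 5 v (.inr m)
      = relu (Atom.val n E c v ((guard m).elim .one .own)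
        - if 0 ≤ Atom.eval n E c v (form m) then 1 else 0) := by
    rw [← k4, ← h4]
    exact step_guardLayer_inr E _ _ v m
  rw [k5]
  rcases hg : guard m with _ | k
  · by_cases hf : 0 ≤ Atom.eval n E c v (form m) <;> simp [hf, relu, Atom.val]
  · by_cases hf : 0 ≤ Atom.eval n E c v (form m) <;> by_cases hk : c v k <;>
      simp [hf, hk, relu, Atom.val]

/-- The last layer computes 1 minus the number of violations, cut off at 0: it is 1 without
violations and 0 otherwise. -/
theorem half_le_run_checkLayers_iff (guard : M → Option K) (form : M → Atom K → ℤ)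
    (ξ : V → Atom K ⊕ M → ℚ) (c : V → K → Prop)
    (h : ∀ v k, ξ v (.inl (.own k)) = Atom.val n E c v (.own k)) (v : V) (x : Atom K ⊕ M) :
    1 / 2 ≤ run (checkLayers guard form n) E ξ 6 v x ↔
      ∀ m, (∀ k ∈ guard m, c v k) → 0 ≤ Atom.eval n E c v (form m) := by
  classical
  have h5 : ∀ a, run (checkLayers guard form n) E ξ 5 v (.inl a) = 0 :=
    fun a => step_guardLayer_inl E _ _ v a
  have h6 : run (checkLayers guard form n) E ξ 6 v x
      = relu (1 - ∑ y, run (checkLayers guard form n) E ξ 5 v y) := step_acceptLayer E _ v x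
  rw [h6, Fintype.sum_sum_type]
  simp only [h5, run_checkLayers_five E n guard form ξ c h, Finset.sum_const_zero, zero_add]
  constructor
  · intro hs m
    by_contra hm
    have h1 := Finset.single_le_sum (f := fun m =>
      if (∀ k ∈ guard m, c v k) → 0 ≤ Atom.eval n E c v (form m) then (0 : ℚ) else 1)
      (fun m _ => by positivity) (Finset.mem_univ m)
    simp only [if_neg hm] at h1
    rw [relu_eq_max, max_eq_left (by linarith)] at hs
    norm_num at hs
  · intro hm
    rw [Finset.sum_eq_zero fun m _ => if_pos (hm m)]
    norm_num [relu]

/-- Local linear constraints, each of them on all vertices or on the vertices of one colour, can be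
checked by a local ReLU network. -/
theorem exists_checking_network (guard : M → Option K) (form : M → Atom K → ℤ) :
    ∃ A : ℕ → GNN, (∀ n, (A n).IsLocal) ∧ (∀ n, (A n).IsReLU) ∧ (Computable fun n => (A n).code) ∧
      ∀ n, (A n).UniversallySatisfiable ↔
        ∃ (V : Type) (_ : Fintype V) (_ : Nonempty V) (E : V → V → Prop) (c : V → K → Prop),
          ∀ v m, (∀ k ∈ guard m, c v k) → 0 ≤ Atom.eval n E c v (form m) := by
  have : Nonempty (Atom K ⊕ M) := ⟨.inl .one⟩
  refine ⟨fun n => toGNN 6 (by norm_num) (checkLayers guard form n), fun n ℓ => rfl, fun n ℓ => rfl,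
    ?_, fun n => ?_⟩
  · refine computable_code_toGNN 6 _ _ ?_ ?_ ?_ ?_
    · rintro n (_ | _ | _ | _ | _ | _) <;> rfl
    · rintro n (_ | _ | _ | _ | _ | _) <;> rfl
    · rintro n (_ | _ | _ | _ | _ | _) <;> rfl
    · rintro (_ | i) x
      · rcases x with (_ | _ | _ | _ | _ | _) | _
        all_goals first
          | exact computable_ratCode_natCast
          | exact .const (GNN.ratCode 0)
          | exact .const (GNN.ratCode 1)
      · refine (Computable.const (GNN.ratCode ((checkLayers guard form 0 (i + 1)).b x))).of_eq
          fun n => ?_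
        rcases i with _ | _ | _ | _ | _ <;> rfl
  · classical
    rw [universallySatisfiable_toGNN]
    · constructor
      · rintro ⟨V, _, _, E, c, h⟩
        refine ⟨V, ‹_›, ‹_›, E, fun v k => c v (.inl (.own k)), fun v => ?_⟩
        refine (half_le_run_checkLayers_iff E n guard form _
          (fun v k => c v (.inl (.own k))) (fun v k => ?_) v (.inl .one)).1
          (h v _)
        simp [Atom.val]
      · rintro ⟨V, _, _, E, c, h⟩
        refine ⟨V, ‹_›, ‹_›, E,
          -- The superfluous input colours are left empty.
          fun v x => ∃ k, x = .inl (.own k) ∧ c v k, fun v x => ?_⟩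
        refine (half_le_run_checkLayers_iff E n guard form _ c (fun v k => ?_) v x).2
          (h v)
        simp [Atom.val]
    · intro V _ E ξ v x y
      exact (step_acceptLayer E _ v x).trans (step_acceptLayer E _ v y).symm

theorem Atom.eval_single (c : V → K → Prop) (v : V) (a : Atom K) :
    Atom.eval n E c v (Pi.single a 1) = Atom.val n E c v a := by
  simp [Atom.eval, Pi.single_apply]

/-- Local linear constraints on graphs whose vertices have exactly one colour each can be checked
by a local ReLU network. -/
theorem exists_network_checking_colorings (loc : K → List (Atom K → ℤ)) :
    ∃ A : ℕ → GNN, (∀ n, (A n).IsLocal) ∧ (∀ n, (A n).IsReLU) ∧ (Computable fun n => (A n).code) ∧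
      ∀ n, (A n).UniversallySatisfiable ↔
        ∃ (V : Type) (_ : Fintype V) (_ : Nonempty V) (E : V → V → Prop) (col : V → K),
          ∀ v, ∀ f ∈ loc (col v), 0 ≤ Atom.eval n E (fun v k => col v = k) v f := by
  -- The number of colours of a vertex minus 1. Imposed unguarded and with both signs, it forces
  -- exactly one colour.
  let colours : Atom K → ℤ := ∑ k, Pi.single (.own k) 1 - Pi.single .one 1
  obtain ⟨A, hA, hA', hA'', hA'''⟩ := exists_checking_network
    (M := Bool ⊕ Σ k, Fin (loc k).length)
    (Sum.elim (fun _ => none) fun p => some p.1)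
    (Sum.elim (fun i => if i then colours else -colours) fun p => (loc p.1)[p.2])
  refine ⟨A, hA, hA', hA'', fun n => (hA''' n).trans ?_⟩
  have hcol : ∀ {V : Type} [Fintype V] (E : V → V → Prop) (c : V → K → Prop) (v : V),
      Atom.eval n E c v colours = 0 ↔ ∃! k, c v k := by
    classical
    intro V _ E c v
    simp only [colours, map_sub, map_sum, Atom.eval_single, Atom.val]
    rw [Fintype.existsUnique_iff_card_one, sub_eq_zero]
    simp
  constructor
  · rintro ⟨V, _, _, E, c, h⟩
    have hc : ∀ v, ∃! k, c v k := fun v => by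
      rw [← hcol E]
      have h1 := h v (.inl true) (by simp)
      have h2 := h v (.inl false) (by simp)
      simp only [Sum.elim_inl, if_true, Bool.false_eq_true, if_false, map_neg] at h1 h2
      omega
    choose col hcol' hcol'' using hc
    have hcc : c = fun v k => col v = k := by
      funext v k
      exact propext ⟨fun hk => (hcol'' v k hk).symm, fun hk => hk ▸ hcol' v⟩
    refine ⟨V, ‹_›, ‹_›, E, col, fun v f hf => ?_⟩
    obtain ⟨i, hi, rfl⟩ := List.mem_iff_getElem.1 hf
    rw [← hcc]
    exact h v (.inr ⟨col v, i, hi⟩) (by simpa using hcol' v)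
  · rintro ⟨V, _, _, E, col, h⟩
    refine ⟨V, ‹_›, ‹_›, E, fun v k => col v = k, ?_⟩
    rintro v (i | ⟨k, i⟩) hg
    · have h0 := (hcol E (fun v k => col v = k) v).2 (by simp)
      cases i <;> simp [h0]
    · obtain rfl : col v = k := by simpa using hg
      exact h v _ (List.getElem_mem _)

end checker

/-! ### Constrained Horn programs over the natural numbers -/

/-- The quantities that the constraints of a rule speak about: the number `1`, the parameter of the
program, the arguments of the conclusion, and the arguments of the premises. -/
inductive RuleVar (S A : Type) where
  | one
  | par
  | own (j : A)
  | sub (s : S) (j : A)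

/-- The value of a quantity. -/
def RuleVar.val {S A : Type} (n : ℕ) (x : A → ℕ) (y : S → A → ℕ) : RuleVar S A → ℕ
  | one => 1
  | par => n
  | own j => x j
  | sub s j => y s j

/-- The value of a formal linear combination. -/
def linEval {S A : Type} (n : ℕ) (x : A → ℕ) (y : S → A → ℕ) (l : List (ℤ × RuleVar S A)) : ℤ :=
  (l.map fun p => p.1 * (p.2.val n x y : ℤ)).sum

/-- A constrained Horn program with rules `T`, predicates `Q` of arity `A`, and premises numbered by
`S`. The constraints say that certain linear combinations are nonnegative. -/
structure HornProgram (T Q S A : Type) where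
  pred : T → Q
  prem : T → S → Option Q
  cons : T → List (List (ℤ × RuleVar S A))
  goal : Q

namespace HornProgram

variable {T Q S A : Type} (P : HornProgram T Q S A)

/-- The facts that the program derives for the parameter `n`. -/
inductive Derivable (n : ℕ) : Q → (A → ℕ) → Prop
  | rule (t : T) (x : A → ℕ) (y : S → A → ℕ) (hc : ∀ l ∈ P.cons t, 0 ≤ linEval n x y l)
      (h0 : ∀ s, P.prem t s = none → y s = 0)
      (hp : ∀ s q, P.prem t s = some q → Derivable n q (y s)) : Derivable n (P.pred t) x

/-- The colours of the graphs that represent derivations: a vertex is the use of a rule as a given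
premise of another rule, or a unit of one of the numbers stored at such a vertex. -/
inductive Colour (T S A : Type) where
  | unit (s : S) (j : Option A)
  | claim (s : S) (t : T)
  deriving Fintype, DecidableEq

namespace Colour

def IsClaim : Colour T S A → Prop
  | unit _ _ => False
  | claim _ _ => True

end Colour

/-! ### Local constraints that describe derivations. -/

section forms

variable [Fintype T] [Fintype S] [Fintype A] [DecidableEq T] [DecidableEq S] [DecidableEq A]

open Classical in
/-- The form that counts the out-neighbours with a property. -/
noncomputable def outForm (p : Colour T S A → Prop) : Atom (Colour T S A) → ℤ :=
  ∑ k with p k, Pi.single (.outc k) 1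

open Classical in
/-- The form that counts the in-neighbours with a property. -/
noncomputable def inForm (p : Colour T S A → Prop) : Atom (Colour T S A) → ℤ :=
  ∑ k with p k, Pi.single (.inc k) 1

/-- The form that stands for a quantity of a rule. -/
def ruleAtom (s : S) : RuleVar S A → Atom (Colour T S A)
  | .one => .one
  | .par => .par
  | .own j => .outc (.unit s (some j))
  | .sub s' j => .walk (.unit s' (some j))

/-- The form that stands for a constraint of a rule. -/
def ruleForm (s : S) (l : List (ℤ × RuleVar S A)) : Atom (Colour T S A) → ℤ :=
  (l.map fun p => p.1 • (Pi.single (ruleAtom s p.2) 1 : Atom (Colour T S A) → ℤ)).sum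

open Classical in
/-- The constraints on a vertex that represents the use of a rule. -/
noncomputable def claimForms (s : S) (t : T) : List (Atom (Colour T S A) → ℤ) :=
  (if P.pred t = P.goal then [] else [inForm Colour.IsClaim - Pi.single .one 1])
    ++ [-outForm fun k => ∃ s' j, s' ≠ s ∧ k = .unit s' j]
    ++ Finset.univ.toList.flatMap (fun s' => (P.prem t s').elim
        [-outForm fun k => ∃ t', k = .claim s' t']
        fun q => [(outForm fun k => ∃ t', k = .claim s' t' ∧ P.pred t' = q) - Pi.single .one 1,
          Pi.single .one 1 - (outForm fun k => ∃ t', k = .claim s' t'),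
          Pi.single (.walk (.unit s' none)) 1 - Pi.single (.outc (.unit s none)) 1
            - Pi.single .one 1])
    ++ (P.cons t).map (ruleForm s)

/-- The local constraints on graphs that represent derivations. -/
noncomputable def locForms : Colour T S A → List (Atom (Colour T S A) → ℤ)
  | .unit _ _ => [inForm Colour.IsClaim - Pi.single .one 1, -outForm fun k => ¬k.IsClaim]
  | .claim s t => P.claimForms s t

variable {V : Type} [Fintype V] (n : ℕ) (E : V → V → Prop) (col : V → Colour T S A)

open Classical in
theorem eval_outForm (v : V) (p : Colour T S A → Prop) :
    Atom.eval n E (fun v k => col v = k) v (outForm p)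
      = (Finset.card {u | E v u ∧ p (col u)} : ℕ) := by
  simp only [outForm, map_sum, Atom.eval_single, Atom.val, Atom.outCount]
  rw [Finset.card_eq_sum_card_fiberwise (f := col) (t := Finset.univ.filter p)
    (fun u hu => by simpa using (Finset.mem_filter.1 hu).2.2)]
  push_cast
  refine Finset.sum_congr rfl fun k hk => ?_
  rw [Finset.filter_filter]
  congr 2
  ext u
  have := (Finset.mem_filter.1 hk).2
  simp only [Finset.mem_filter, Finset.mem_univ, true_and]
  exact ⟨fun h => ⟨⟨h.1, h.2 ▸ this⟩, h.2⟩, fun h => ⟨h.1.1, h.2⟩⟩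

open Classical in
theorem eval_inForm (v : V) (p : Colour T S A → Prop) :
    Atom.eval n E (fun v k => col v = k) v (inForm p)
      = (Finset.card {u | E u v ∧ p (col u)} : ℕ) := by
  simp only [inForm, map_sum, Atom.eval_single, Atom.val]
  rw [Finset.card_eq_sum_card_fiberwise (f := col) (t := Finset.univ.filter p)
    (fun u hu => by simpa using (Finset.mem_filter.1 hu).2.2)]
  push_cast
  refine Finset.sum_congr rfl fun k hk => ?_
  rw [Finset.filter_filter]
  congr 2
  ext u
  have := (Finset.mem_filter.1 hk).2
  simp only [Finset.mem_filter, Finset.mem_univ, true_and]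
  exact ⟨fun h => ⟨⟨h.1, h.2 ▸ this⟩, h.2⟩, fun h => ⟨h.1.1, h.2⟩⟩

theorem neg_outForm_nonneg_iff (v : V) (p : Colour T S A → Prop) :
    0 ≤ Atom.eval n E (fun v k => col v = k) v (-outForm p) ↔ ∀ u, E v u → ¬p (col u) := by
  classical
  rw [map_neg, eval_outForm, Left.nonneg_neg_iff, Nat.cast_nonpos, Finset.card_eq_zero,
    Finset.filter_eq_empty_iff]
  simp

theorem outForm_sub_one_nonneg_iff (v : V) (p : Colour T S A → Prop) :
    0 ≤ Atom.eval n E (fun v k => col v = k) v (outForm p - Pi.single .one 1)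
      ↔ ∃ u, E v u ∧ p (col u) := by
  classical
  rw [map_sub, eval_outForm, Atom.eval_single, Atom.val, Nat.cast_one, sub_nonneg,
    Nat.one_le_cast, Finset.one_le_card]
  simp [Finset.Nonempty]

theorem one_sub_outForm_nonneg_iff (v : V) (p : Colour T S A → Prop) :
    0 ≤ Atom.eval n E (fun v k => col v = k) v (Pi.single .one 1 - outForm p)
      ↔ ∀ u u', E v u → E v u' → p (col u) → p (col u') → u = u' := by
  classical
  rw [map_sub, eval_outForm, Atom.eval_single, Atom.val, Nat.cast_one, sub_nonneg,
    Nat.cast_le_one, Finset.card_le_one]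
  simp only [Finset.mem_filter, Finset.mem_univ, true_and]
  exact ⟨fun h u u' hu hu' hp hp' => h u ⟨hu, hp⟩ u' ⟨hu', hp'⟩,
    fun h u hu u' hu' => h u u' hu.1 hu'.1 hu.2 hu'.2⟩

theorem inForm_sub_one_nonneg_iff (v : V) (p : Colour T S A → Prop) :
    0 ≤ Atom.eval n E (fun v k => col v = k) v (inForm p - Pi.single .one 1)
      ↔ ∃ u, E u v ∧ p (col u) := by
  classical
  rw [map_sub, eval_inForm, Atom.eval_single, Atom.val, Nat.cast_one, sub_nonneg,
    Nat.one_le_cast, Finset.one_le_card]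
  simp [Finset.Nonempty]

/-- The number of out-neighbours of colour `k`. -/
noncomputable abbrev out (v : V) (k : Colour T S A) : ℕ :=
  Atom.outCount E (fun v k => col v = k) v k

open Classical in
/-- The number of two-step out-walks that end in colour `k`. -/
noncomputable abbrev walk (v : V) (k : Colour T S A) : ℕ :=
  ∑ u with E v u, out E col u k

theorem eval_ruleForm (v : V) (s : S) (l : List (ℤ × RuleVar S A)) :
    Atom.eval n E (fun v k => col v = k) v (ruleForm s l)
      = linEval n (fun j => out E col v (.unit s (some j)))
          (fun s' j => walk E col v (.unit s' (some j))) l := by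
  simp only [ruleForm, linEval, map_list_sum, List.map_map]
  congr 2
  funext p
  simp only [Function.comp, map_zsmul, Atom.eval_single, smul_eq_mul]
  congr 2
  rcases p.2 <;> rfl

/-- The in-neighbour keeps a nonempty graph from consisting of units only. The condition on
out-neighbours keeps walks through units from adding to the counts of stored numbers. -/
theorem unit_forms_iff (v : V) (s : S) (j : Option A) :
    (∀ f ∈ P.locForms (.unit s j), 0 ≤ Atom.eval n E (fun v k => col v = k) v f) ↔
      (∃ u, E u v ∧ (col u).IsClaim) ∧ ∀ u, E v u → (col u).IsClaim := by
  simp only [locForms, List.forall_mem_cons, List.not_mem_nil, false_imp_iff, implies_true,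
    and_true, inForm_sub_one_nonneg_iff, neg_outForm_nonneg_iff, not_not]

/-- In order: only a claim of the goal may lack a parent; the units of a claim carry its own slot;
absent premises have no child; a present premise has exactly one child in its slot, with the right
predicate and a larger depth; the constraints of the rule hold for the stored numbers. -/
theorem claim_forms_iff (v : V) (s : S) (t : T) :
    (∀ f ∈ P.locForms (.claim s t), 0 ≤ Atom.eval n E (fun v k => col v = k) v f) ↔
      (P.pred t ≠ P.goal → ∃ u, E u v ∧ (col u).IsClaim) ∧
      (∀ u s' j, E v u → col u = .unit s' j → s' = s) ∧
      (∀ s', P.prem t s' = none → ∀ u t', E v u → col u ≠ .claim s' t') ∧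
      (∀ s' q, P.prem t s' = some q →
        (∃ u t', E v u ∧ col u = .claim s' t' ∧ P.pred t' = q) ∧
        (∀ u u' t₁ t₂, E v u → E v u' → col u = .claim s' t₁ → col u' = .claim s' t₂ → u = u') ∧
        out E col v (.unit s none) < walk E col v (.unit s' none)) ∧
      ∀ l ∈ P.cons t, 0 ≤ linEval n (fun j => out E col v (.unit s (some j)))
          (fun s' j => walk E col v (.unit s' (some j))) l := by
  simp only [locForms, claimForms, List.forall_mem_append, List.forall_mem_cons, List.not_mem_nil,
    false_imp_iff, implies_true, and_true, and_assoc, List.forall_mem_map, eval_ruleForm]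
  refine and_congr ?_ (and_congr ?_ ?_)
  · split_ifs with h
    · simp [h]
    · simp only [List.forall_mem_cons, List.not_mem_nil, false_imp_iff, implies_true, and_true,
        inForm_sub_one_nonneg_iff, ne_eq, h, not_false_eq_true, true_imp_iff]
  · rw [neg_outForm_nonneg_iff]
    exact ⟨fun h u s' j hu hc => by_contra fun hs => h u hu ⟨s', j, hs, hc⟩,
      fun h u hu ⟨s', j, hs, hc⟩ => hs (h u s' j hu hc)⟩
  · rw [← and_assoc]
    refine and_congr ?_ Iff.rfl
    rw [← forall_and]
    simp only [List.mem_flatMap, Finset.mem_toList, Finset.mem_univ, true_and,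
      forall_exists_index]
    rw [forall_comm]
    refine forall_congr' fun s' => ?_
    rcases P.prem t s' with _ | q
    · simp only [Option.elim_none, List.forall_mem_cons, List.not_mem_nil, false_imp_iff,
        implies_true, and_true, true_imp_iff, reduceCtorEq, neg_outForm_nonneg_iff, not_exists]
      exact forall_congr' fun u => forall_comm
    · simp only [Option.elim_some, List.forall_mem_cons, List.not_mem_nil, false_imp_iff,
        implies_true, and_true, true_and, reduceCtorEq, Option.some.injEq, forall_eq',
        outForm_sub_one_nonneg_iff, one_sub_outForm_nonneg_iff]
      refine and_congr ?_ (and_congr ?_ ?_)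
      · simp only [exists_and_left]
      · exact ⟨fun h u u' t₁ t₂ hu hu' h1 h2 => h u u' hu hu' ⟨t₁, h1⟩ ⟨t₂, h2⟩,
          fun h u u' hu hu' ⟨t₁, h1⟩ ⟨t₂, h2⟩ => h u u' t₁ t₂ hu hu' h1 h2⟩
      · simp only [map_sub, Atom.eval_single, Atom.val, out, walk]
        omega

end forms
end HornProgram

/-! ### From graphs to derivations. -/

namespace HornProgram

variable {T Q S A : Type} {P : HornProgram T Q S A}

section graphs

variable {V : Type} [Fintype V] {n : ℕ} {E : V → V → Prop} {col : V → Colour T S A}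

/-- Only claims of slot `s` have units of slot `s` as out-neighbours, so every walk counted passes
through the single child `u`. Other parents of `u` or of its units do not affect the count. -/
theorem walk_eq_out (hout : ∀ v s j, (∀ t, col v ≠ .claim s t) → out E col v (.unit s j) = 0)
    {u v : V} {s : S} (hu : E v u) (huniq : ∀ u' t, E v u' → col u' = .claim s t → u' = u)
    (j : Option A) : walk E col v (.unit s j) = out E col u (.unit s j) := by
  classical
  refine Finset.sum_eq_single u (fun u' hu' hne => hout u' s j fun t ht => ?_) fun h => ?_
  · exact hne (huniq u' t (by simpa using hu') ht)
  · exact absurd (by simpa using hu) h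

theorem walk_eq_zero (hout : ∀ v s j, (∀ t, col v ≠ .claim s t) → out E col v (.unit s j) = 0)
    {v : V} {s : S} (hv : ∀ u t, E v u → col u ≠ .claim s t) (j : Option A) :
    walk E col v (.unit s j) = 0 := by
  classical
  exact Finset.sum_eq_zero fun u hu => hout u s j fun t => hv u t (by simpa using hu)

theorem out_eq_zero (hunit : ∀ v s j, col v = .unit s j → ∀ u, E v u → (col u).IsClaim)
    (hclaim : ∀ v s t, col v = .claim s t → ∀ u s' j, E v u → col u = .unit s' j → s' = s)
    (v : V) (s : S) (j : Option A) (hv : ∀ t, col v ≠ .claim s t) :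
    out E col v (.unit s j) = 0 := by
  rw [out, Atom.outCount_eq_card, Nat.card_eq_zero]
  refine Or.inl ⟨fun ⟨u, hu⟩ => ?_⟩
  rcases hc : col v with ⟨s', j'⟩ | ⟨s', t⟩
  · have := hunit v s' j' hc u hu.1
    rw [hu.2] at this
    exact this
  · exact hv t (hclaim v s' t hc u s j hu.1 hu.2 ▸ hc)

variable [Fintype T] [Fintype S] [Fintype A] [DecidableEq T] [DecidableEq S] [DecidableEq A]

/-- Every claim is derivable, by induction from large depths to small ones; a claim of least depth
then supplies the goal. -/
theorem exists_derivable_of_graph [Nonempty V]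
    (h : ∀ v, ∀ f ∈ P.locForms (col v), 0 ≤ Atom.eval n E (fun v k => col v = k) v f) :
    ∃ x, P.Derivable n P.goal x := by
  have hU : ∀ v s j, col v = .unit s j → _ := fun v s j hv =>
    (P.unit_forms_iff n E col v s j).1 (hv ▸ h v)
  have hC : ∀ v s t, col v = .claim s t → _ := fun v s t hv =>
    (P.claim_forms_iff n E col v s t).1 (hv ▸ h v)
  have hout := out_eq_zero (fun v s j hv => (hU v s j hv).2) fun v s t hv => (hC v s t hv).2.1
  -- The value at units is a dummy; only the depths of claims carry information.
  let depth : V → ℕ := fun v => match col v with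
    | .unit _ _ => 0
    | .claim s _ => out E col v (.unit s none)
  have hdepth : ∀ {v s t}, col v = .claim s t → depth v = out E col v (.unit s none) := by
    intro v s t hv
    simp only [depth, hv]
  have hchild : ∀ {u v s t s' t'}, col v = .claim s t → col u = .claim s' t' → E v u →
      (∀ j, walk E col v (.unit s' j) = out E col u (.unit s' j)) ∧ depth v < depth u := by
    intro u v s t s' t' hv hu huv
    obtain ⟨-, -, h0, h1, -⟩ := hC v s t hv
    rcases hp : P.prem t s' with _ | q
    · exact absurd hu (h0 s' hp u t' huv)
    · obtain ⟨-, h2, h3⟩ := h1 s' q hp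
      have hw := walk_eq_out hout huv fun u' t'' hu' hc => h2 u' u t'' t' hu' huv hc hu
      exact ⟨hw, by rw [hdepth hv, hdepth hu, ← hw]; exact h3⟩
  -- Depths increase towards premises, so the induction runs downwards from large depths; finiteness
  -- of the graph makes this well-founded.
  have hwf : WellFounded fun u v : V => depth v < depth u := by
    have : IsTrans V fun u v => depth v < depth u := ⟨fun _ _ _ h1 h2 => h2.trans h1⟩
    have : Std.Irrefl fun u v : V => depth v < depth u := ⟨fun _ => lt_irrefl _⟩
    exact Finite.wellFounded_of_trans_of_irrefl _
  have hder : ∀ v s t, col v = .claim s t →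
      P.Derivable n (P.pred t) fun j => out E col v (.unit s (some j)) := by
    intro v
    induction v using hwf.induction with
    | _ v ih =>
    intro s t hv
    obtain ⟨-, -, h0, h1, h2⟩ := hC v s t hv
    refine .rule t _ _ h2 (fun s' hs' => ?_) fun s' q hq => ?_
    · funext j
      exact walk_eq_zero hout (h0 s' hs') (some j)
    · obtain ⟨⟨u, t', hvu, hu, rfl⟩, -, -⟩ := h1 s' q hq
      obtain ⟨hw, hlt⟩ := hchild hv hu hvu
      simp only [hw]
      exact ih u hlt s' t' hu
  have hex : ∃ v, (col v).IsClaim := by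
    obtain ⟨v⟩ := ‹Nonempty V›
    rcases hv : col v with ⟨s, j⟩ | ⟨s, t⟩
    · exact ((hU v s j hv).1).imp fun u hu => hu.2
    · exact ⟨v, by rw [hv]; trivial⟩
  obtain ⟨v, hv, hmin⟩ := (measure depth).wf.has_min {v | (col v).IsClaim} hex
  rcases hc : col v with ⟨s, j⟩ | ⟨s, t⟩
  · rw [Set.mem_ofPred_eq, hc] at hv
    exact hv.elim
  · by_cases hg : P.pred t = P.goal
    · exact ⟨_, hg ▸ hder v s t hc⟩
    -- A claim not concluding the goal has a claim as in-neighbour, whose depth is smaller.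
    · obtain ⟨u, huv, hu⟩ := (hC v s t hc).1 hg
      rcases hcu : col u with ⟨s', j⟩ | ⟨s', t'⟩
      · rw [hcu] at hu
        exact hu.elim
      · exact absurd (hchild hcu hc huv).2 (hmin u (by rw [Set.mem_ofPred_eq, hcu]; trivial))

end graphs

/-! ### Graphs from derivations -/

/-- Derivation trees; `nil` stands for an absent premise. -/
inductive DTree (T S A : Type) where
  | nil
  | node (t : T) (x : A → ℕ) (ch : S → DTree T S A)

namespace DTree

/-- The arguments of the derived fact. -/
def args : DTree T S A → A → ℕ
  | nil => 0
  | node _ x _ => x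

/-- The predicate of the derived fact. -/
def label (P : HornProgram T Q S A) : DTree T S A → Option Q
  | nil => none
  | node t _ _ => some (P.pred t)

/-- All rules are applied correctly. -/
def Valid (P : HornProgram T Q S A) (n : ℕ) : DTree T S A → Prop
  | nil => True
  | node t x ch => (∀ l ∈ P.cons t, 0 ≤ linEval n x (fun s => (ch s).args) l) ∧
      ∀ s, (ch s).Valid P n ∧ (ch s).label P = P.prem t s

end DTree

/-- `Derivable` is a proposition, so vertices cannot be read off its proofs; a tree makes the chosen
rules and premises into data. Absent premises have zero arguments on both sides. -/
theorem Derivable.exists_tree {n : ℕ} {q : Q} {x : A → ℕ} (h : P.Derivable n q x) :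
    ∃ tr : DTree T S A, tr.Valid P n ∧ tr.label P = some q ∧ tr.args = x := by
  induction h with
  | rule t x y hc h0 hp ih =>
    have : ∀ s, ∃ tr : DTree T S A, tr.Valid P n ∧ tr.label P = P.prem t s ∧ tr.args = y s := by
      intro s
      rcases hs : P.prem t s with _ | q
      · exact ⟨.nil, trivial, rfl, (h0 s hs).symm⟩
      · exact ih s q hs
    choose ch h1 h2 h3 using this
    exact ⟨.node t x ch, ⟨by simpa only [h3] using hc, fun s => ⟨h1 s, h2 s⟩⟩, rfl, rfl⟩

/-- A node of a derivation tree, with the subtree at it, the number of the premise that it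
derives, and its depth. -/
structure Node (T S A : Type) where
  t : T
  x : A → ℕ
  ch : S → DTree T S A
  s : S
  d : ℕ

namespace Node

/-- The subtree at a node. -/
def tree (p : Node T S A) : DTree T S A := .node p.t p.x p.ch

/-- `p'` is a child of `p`. -/
def Child (p p' : Node T S A) : Prop := p.ch p'.s = p'.tree ∧ p'.d = p.d + 1

/-- Structural induction on the subtree: there are finitely many slots, and at most one child in
each. Equal subtrees with the same slot and depth give the same node, so the resulting graph may
share subderivations. -/
theorem finite_descendants [Finite S] (tr : DTree T S A) :
    ∀ p : Node T S A, p.tree = tr → {p' | Relation.ReflTransGen Child p p'}.Finite := by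
  induction tr with
  | nil => intro p hp; cases hp
  | node t x ch ih =>
    intro p hp
    obtain rfl : p.ch = ch := by cases hp; rfl
    have : {p' | Relation.ReflTransGen Child p p'} ⊆ {p} ∪ ⋃ s, ⋃ c ∈ {c : Node T S A |
        c.s = s ∧ c.d = p.d + 1 ∧ c.tree = p.ch s}, {p' | Relation.ReflTransGen Child c p'} := by
      intro p' hp'
      rcases hp'.cases_head with rfl | ⟨c, hc, hcp⟩
      · exact Or.inl rfl
      · refine Or.inr (Set.mem_iUnion.2 ⟨c.s, Set.mem_iUnion₂.2 ⟨c, ⟨rfl, hc.2, hc.1.symm⟩, hcp⟩⟩)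
    refine ((Set.finite_singleton p).union (Set.finite_iUnion fun s => ?_)).subset this
    -- A node is determined by its subtree, slot and depth.
    refine Set.Finite.biUnion (Set.Subsingleton.finite ?_) fun c hc => ih s c hc.2.2
    rintro ⟨t, x, ch, s, d⟩ ⟨rfl, rfl, h1⟩ ⟨t', x', ch', s', d'⟩ ⟨h2, rfl, h3⟩
    have h4 := h1.trans h3.symm
    simp only [tree, DTree.node.injEq] at h4
    obtain ⟨rfl, rfl, rfl⟩ := h4
    simp only at h2
    subst h2
    rfl

/-- The numbers stored at a node. -/
def num (p : Node T S A) : Option A → ℕ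
  | none => p.d
  | some j => p.x j

variable (N : Set (Node T S A))

/-- The vertices of the graph of a set of nodes: the nodes, and units of the stored numbers. -/
abbrev Vertex : Type := N ⊕ Σ (p : N) (j : Option A), Fin (p.1.num j)

/-- The edges of the graph of a set of nodes. -/
def Edge : Vertex N → Vertex N → Prop
  | .inl p, .inl p' => Child p.1 p'.1
  | .inl p, .inr u => u.1 = p
  | .inr _, _ => False

/-- The colours of the vertices. -/
def col : Vertex N → Colour T S A
  | .inl p => .claim p.1.s p.1.t
  | .inr u => .unit u.1.1.s u.2.1

theorem out_node [Fintype (Vertex N)] (p : N) (j : Option A) :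
    out (Edge N) (col N) (.inl p) (.unit p.1.s j) = p.1.num j := by
  rw [out, Atom.outCount_eq_card, ← Nat.card_fin (p.1.num j)]
  refine (Nat.card_eq_of_bijective (fun i => ⟨.inr ⟨p, j, i⟩, rfl, rfl⟩) ⟨fun i i' h => ?_, ?_⟩).symm
  · simpa using h
  · rintro ⟨p' | ⟨p', j', i⟩, hu, hc⟩
    · cases hc
    · obtain rfl : p' = p := hu
      cases hc
      exact ⟨i, rfl⟩

end Node

variable [Fintype T] [Fintype S] [Fintype A] [DecidableEq T] [DecidableEq S] [DecidableEq A]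

/-- The graph consists of the descendants of the root together with units for their numbers.
Reachability gives every node other than the root a parent, and the root concludes the goal. -/
theorem exists_graph_of_derivable [Nonempty S] {n : ℕ} {x : A → ℕ}
    (h : P.Derivable n P.goal x) :
    ∃ (V : Type) (_ : Fintype V) (_ : Nonempty V) (E : V → V → Prop) (col : V → Colour T S A),
      ∀ v, ∀ f ∈ P.locForms (col v), 0 ≤ Atom.eval n E (fun v k => col v = k) v f := by
  obtain ⟨_ | ⟨t, x, ch⟩, hval, hlab, -⟩ := h.exists_tree
  · cases hlab
  obtain ⟨s⟩ := ‹Nonempty S›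
  -- The root is a premise of nothing, so its slot is arbitrary.
  let r : Node T S A := ⟨t, x, ch, s, 0⟩
  let N : Set (Node T S A) := {p | Relation.ReflTransGen Node.Child r p}
  have hN : N.Finite := Node.finite_descendants _ r rfl
  have : Fintype N := hN.fintype
  have hvalid : ∀ p ∈ N, p.tree.Valid P n := by
    intro p hp
    induction hp with
    | refl => exact hval
    | tail _ hc ih => exact hc.1 ▸ (ih.2 _).1
  have hU : ∀ v s j, Node.col N v = .unit s j → ∀ u, Node.Edge N v u → (Node.col N u).IsClaim := by
    rintro (p | ⟨p, j, i⟩) s' j' hv u hu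
    · cases hv
    · exact hu.elim
  have hC : ∀ v s t, Node.col N v = .claim s t →
      ∀ u s' j, Node.Edge N v u → Node.col N u = .unit s' j → s' = s := by
    rintro (p | ⟨p, j, i⟩) s' t' hv (p' | ⟨p', j', i'⟩) s'' j hu hc
    · cases hc
    · obtain rfl : p' = p := hu
      cases hv
      cases hc
      rfl
    · cases hv
    · cases hv
  have hout := out_eq_zero hU hC
  refine ⟨Node.Vertex N, inferInstance, ⟨.inl ⟨r, .refl⟩⟩, Node.Edge N, Node.col N, ?_⟩
  rintro (p | ⟨p, j, i⟩)
  · obtain ⟨hcons, hsub⟩ := hvalid p p.2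
    have hchild : ∀ {s' q}, P.prem p.1.t s' = some q → ∃ p' : N, Node.Edge N (.inl p) (.inl p') ∧
        p'.1.s = s' ∧ P.pred p'.1.t = q := by
      intro s' q hq
      have hl := (hsub s').2.trans hq
      rcases hc : p.1.ch s' with _ | ⟨t', x', ch'⟩
      · rw [hc] at hl
        cases hl
      · have hE : Node.Child p.1 ⟨t', x', ch', s', p.1.d + 1⟩ := ⟨hc, rfl⟩
        refine ⟨⟨_, p.2.tail hE⟩, hE, rfl, ?_⟩
        rw [hc] at hl
        exact Option.some.inj hl
    have huniq : ∀ {s' : S} {p' : N}, Node.Edge N (.inl p) (.inl p') → p'.1.s = s' →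
        ∀ u t', Node.Edge N (.inl p) u → Node.col N u = .claim s' t' → u = .inl p' := by
      rintro s' p' hp' rfl (p'' | u) t' hu hc
      · have hs : p''.1.s = p'.1.s := by
          simp only [Node.col, Colour.claim.injEq] at hc
          exact hc.1
        have ht := hu.1.symm.trans ((congrArg _ hs).trans hp'.1)
        obtain ⟨⟨t1, x1, ch1, s1, d1⟩, h1⟩ := p''
        obtain ⟨⟨t2, x2, ch2, s2, d2⟩, h2⟩ := p'
        have hd : d1 = d2 := hu.2.trans hp'.2.symm
        simp only [Node.tree, DTree.node.injEq] at ht hs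
        obtain ⟨rfl, rfl, rfl⟩ := ht
        subst hs hd
        rfl
      · cases hc
    have hwalk : ∀ {s' : S} {p' : N}, Node.Edge N (.inl p) (.inl p') → p'.1.s = s' →
        ∀ j, walk (Node.Edge N) (Node.col N) (.inl p) (.unit s' j) = p'.1.num j := by
      rintro s' p' hp' rfl j
      rw [walk_eq_out hout hp' (huniq hp' rfl), Node.out_node]
    have hnone : ∀ s', P.prem p.1.t s' = none → ∀ u t', Node.Edge N (.inl p) u →
        Node.col N u ≠ .claim s' t' := by
      rintro s' hs' (p' | u) t' hu hc
      · cases hc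
        have hl := (hsub p'.1.s).2.trans hs'
        rw [hu.1] at hl
        cases hl
      · cases hc
    refine (P.claim_forms_iff n _ _ _ p.1.s p.1.t).2 ⟨fun hg => ?_, hC _ _ _ rfl, hnone,
      fun s' q hq => ?_, ?_⟩
    · rcases Relation.ReflTransGen.cases_tail p.2 with hr | ⟨p', hp', hc⟩
      · refine absurd ?_ hg
        rw [hr]
        exact Option.some.inj hlab
      · exact ⟨.inl ⟨p', hp'⟩, hc, trivial⟩
    · obtain ⟨p', hp', hs', hpred⟩ := hchild hq
      refine ⟨⟨.inl p', p'.1.t, hp', ?_, hpred⟩, fun u u' t₁ t₂ hu hu' h1 h2 => ?_, ?_⟩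
      · rw [← hs']
        rfl
      · rw [huniq hp' hs' u t₁ hu h1, huniq hp' hs' u' t₂ hu' h2]
      · rw [hwalk hp' hs', Node.out_node]
        exact (Nat.lt_succ_self _).trans_eq hp'.2.symm
    · have hx : (fun j => out (Node.Edge N) (Node.col N) (.inl p) (.unit p.1.s (some j))) = p.1.x :=
        funext fun j => Node.out_node N p (some j)
      -- For an absent premise there are no walks, which agrees with the zero arguments of `nil`.
      have hy : (fun s' j => walk (Node.Edge N) (Node.col N) (.inl p) (.unit s' (some j)))
          = fun s' => (p.1.ch s').args := by
        funext s' j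
        rcases hq : P.prem p.1.t s' with _ | q
        · rw [walk_eq_zero hout (hnone s' hq)]
          have hl := (hsub s').2.trans hq
          rcases hc : p.1.ch s' with _ | _
          · rfl
          · rw [hc] at hl
            cases hl
        · obtain ⟨p', hp', rfl, -⟩ := hchild hq
          rw [hwalk hp' rfl, hp'.1]
          rfl
      rw [hx, hy]
      exact hcons
  · exact (P.unit_forms_iff n _ _ _ p.1.s j).2 ⟨⟨.inl p, rfl, trivial⟩, fun u hu => hu.elim⟩

/-- Whether a constrained Horn program derives its goal for a given parameter can be reduced to
universal satisfiability of local ReLU networks. -/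
theorem exists_networks [Nonempty S] (P : HornProgram T Q S A) :
    ∃ A : ℕ → GNN, (∀ n, (A n).IsLocal) ∧ (∀ n, (A n).IsReLU) ∧ (Computable fun n => (A n).code) ∧
      ∀ n, (A n).UniversallySatisfiable ↔ ∃ x, P.Derivable n P.goal x := by
  obtain ⟨N, h1, h2, h3, h4⟩ := exists_network_checking_colorings P.locForms
  refine ⟨N, h1, h2, h3, fun n => (h4 n).trans ⟨?_, ?_⟩⟩
  · rintro ⟨V, _, _, E, col, h⟩
    exact exists_derivable_of_graph h
  · rintro ⟨x, hx⟩
    exact exists_graph_of_derivable hx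

end HornProgram

/-! ### A constrained Horn program that interprets codes of partial recursive functions -/

namespace CodeInterpreter

open Nat.Partrec

/-- The predicates of the interpreter: squares, Cantor pairs, evaluation, and halting. -/
inductive Pred where
  | sq
  | pair
  | ev
  | goal

/-- The rules of the interpreter. -/
inductive Rule where
  | sqZero
  | sqSucc
  | pairLt
  | pairGe
  | evZero
  | evSucc
  | evLeft
  | evRight
  | evPair
  | evComp
  | evPrecZero
  | evPrecSucc
  | evFindZero
  | evFindSucc
  | halt
  deriving DecidableEq

namespace Rule

instance : Fintype Rule :=
  Fintype.ofList [sqZero, sqSucc, pairLt, pairGe, evZero, evSucc, evLeft, evRight, evPair, evComp,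
    evPrecZero, evPrecSucc, evFindZero, evFindSucc, halt] (by rintro (_ | _) <;> simp)

/-- The predicate in the conclusion of a rule. -/
def pred : Rule → Pred
  | sqZero | sqSucc => .sq
  | pairLt | pairGe => .pair
  | halt => .goal
  | _ => .ev

/-- The predicates in the premises of a rule. -/
def prems : Rule → List Pred
  | sqZero | evZero | evSucc => []
  | sqSucc | pairLt | pairGe => [.sq]
  | evLeft | evRight => [.pair]
  | evPair => [.pair, .ev, .ev, .pair]
  | evComp => [.pair, .ev, .ev]
  | evPrecZero => [.pair, .pair, .ev]
  | evPrecSucc => [.pair, .pair, .pair, .ev, .pair, .pair, .ev]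
  | evFindZero => [.pair, .ev]
  | evFindSucc => [.pair, .ev, .pair, .ev]
  | halt => [.ev]

/-- Formal linear combinations of the quantities of a rule. -/
abbrev Lin : Type := List (ℤ × RuleVar (Fin 7) (Fin 3))

open RuleVar in
/-- The combinations that have to be nonnegative. -/
def ges : Rule → List Lin
  | pairLt => [[(1, own 1), (-1, own 0), (-1, one)]]
  | pairGe => [[(1, own 0), (-1, own 1)]]
  | evFindSucc => [[(1, sub 1 2), (-1, one)]]
  | _ => []

open RuleVar in
/-- The combinations that have to vanish. -/
def eqs : Rule → List Lin
  | sqZero => [[(1, own 0)], [(1, own 1)]]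
  | sqSucc => [[(1, sub 0 0), (1, one), (-1, own 0)],
      [(1, sub 0 1), (2, sub 0 0), (1, one), (-1, own 1)]]
  | pairLt => [[(1, sub 0 0), (-1, own 1)], [(1, sub 0 1), (1, own 0), (-1, own 2)]]
  | pairGe => [[(1, sub 0 0), (-1, own 0)], [(1, sub 0 1), (1, own 0), (1, own 1), (-1, own 2)]]
  | evZero => [[(1, own 0)], [(1, own 2)]]
  | evSucc => [[(1, own 0), (-1, one)], [(1, own 1), (1, one), (-1, own 2)]]
  | evLeft => [[(1, own 0), (-2, one)], [(1, sub 0 2), (-1, own 1)], [(1, sub 0 0), (-1, own 2)]]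
  | evRight => [[(1, own 0), (-3, one)], [(1, sub 0 2), (-1, own 1)], [(1, sub 0 1), (-1, own 2)]]
  | evPair => [[(4, sub 0 2), (4, one), (-1, own 0)],
      [(1, sub 1 0), (-1, sub 0 0)], [(1, sub 1 1), (-1, own 1)],
      [(1, sub 2 0), (-1, sub 0 1)], [(1, sub 2 1), (-1, own 1)],
      [(1, sub 3 0), (-1, sub 1 2)], [(1, sub 3 1), (-1, sub 2 2)], [(1, sub 3 2), (-1, own 2)]]
  | evComp => [[(4, sub 0 2), (6, one), (-1, own 0)],
      [(1, sub 1 0), (-1, sub 0 1)], [(1, sub 1 1), (-1, own 1)],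
      [(1, sub 2 0), (-1, sub 0 0)], [(1, sub 2 1), (-1, sub 1 2)], [(1, sub 2 2), (-1, own 2)]]
  | evPrecZero => [[(4, sub 0 2), (5, one), (-1, own 0)],
      [(1, sub 1 1)], [(1, sub 1 2), (-1, own 1)],
      [(1, sub 2 0), (-1, sub 0 0)], [(1, sub 2 1), (-1, sub 1 0)], [(1, sub 2 2), (-1, own 2)]]
  | evPrecSucc => [[(4, sub 0 2), (5, one), (-1, own 0)],
      [(1, sub 1 2), (-1, own 1)],
      [(1, sub 2 0), (-1, sub 1 0)], [(1, sub 2 1), (1, one), (-1, sub 1 1)],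
      [(1, sub 3 0), (-1, own 0)], [(1, sub 3 1), (-1, sub 2 2)],
      [(1, sub 4 0), (-1, sub 2 1)], [(1, sub 4 1), (-1, sub 3 2)],
      [(1, sub 5 0), (-1, sub 1 0)], [(1, sub 5 1), (-1, sub 4 2)],
      [(1, sub 6 0), (-1, sub 0 1)], [(1, sub 6 1), (-1, sub 5 2)], [(1, sub 6 2), (-1, own 2)]]
  | evFindZero => [[(4, sub 1 0), (7, one), (-1, own 0)], [(1, sub 0 2), (-1, own 1)],
      [(1, sub 1 1), (-1, own 1)], [(1, sub 1 2)], [(1, sub 0 1), (-1, own 2)]]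
  | evFindSucc => [[(4, sub 1 0), (7, one), (-1, own 0)], [(1, sub 0 2), (-1, own 1)],
      [(1, sub 1 1), (-1, own 1)], [(1, sub 2 0), (-1, sub 0 0)],
      [(1, sub 0 1), (1, one), (-1, sub 2 1)],
      [(1, sub 3 0), (-1, own 0)], [(1, sub 3 1), (-1, sub 2 2)], [(1, sub 3 2), (-1, own 2)]]
  | halt => [[(1, sub 0 0), (-1, par)], [(1, sub 0 1)]]

end Rule

/-- The interpreter. -/
def program : HornProgram Rule Pred (Fin 7) (Fin 3) where
  pred := Rule.pred
  prem t s := t.prems[s.val]?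
  cons t := t.ges ++ t.eqs.flatMap fun l => [l, l.map fun p => (-p.1, p.2)]
  goal := .goal

theorem linEval_neg {S A : Type} (n : ℕ) (x : A → ℕ) (y : S → A → ℕ)
    (l : List (ℤ × RuleVar S A)) :
    linEval n x y (l.map fun p => (-p.1, p.2)) = -linEval n x y l := by
  induction l with
  | nil => rfl
  | cons p l ih =>
    simp only [linEval, List.map_cons, List.sum_cons] at ih ⊢
    rw [ih]
    ring

theorem program_cons_iff (n : ℕ) (x : Fin 3 → ℕ) (y : Fin 7 → Fin 3 → ℕ) (t : Rule) :
    (∀ l ∈ program.cons t, 0 ≤ linEval n x y l) ↔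
      (∀ l ∈ t.ges, 0 ≤ linEval n x y l) ∧ ∀ l ∈ t.eqs, linEval n x y l = 0 := by
  simp only [program, List.forall_mem_append]
  refine and_congr Iff.rfl ⟨fun h l hl => ?_, fun h l hl => ?_⟩
  · have h1 := h l (List.mem_flatMap.2 ⟨l, hl, by simp⟩)
    have h2 := h _ (List.mem_flatMap.2 ⟨l, hl, List.mem_cons_of_mem _ (List.mem_singleton.2 rfl)⟩)
    rw [linEval_neg] at h2
    omega
  · obtain ⟨l', hl', hl⟩ := List.mem_flatMap.1 hl
    simp only [List.mem_cons, List.not_mem_nil, or_false] at hl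
    rcases hl with rfl | rfl
    · exact (h _ hl').ge
    · rw [linEval_neg, h _ hl', neg_zero]

/-- Premises are supplied as a list of argument vectors; slots beyond its end get 0, as the program
demands of absent premises. -/
theorem derivable_of_rule {n : ℕ} (t : Rule) (x : Fin 3 → ℕ) (ys : List (Fin 3 → ℕ))
    (h1 : ∀ l ∈ t.ges, 0 ≤ linEval n x (fun s : Fin 7 => ys[s.val]?.getD 0) l)
    (h2 : ∀ l ∈ t.eqs, linEval n x (fun s : Fin 7 => ys[s.val]?.getD 0) l = 0)
    (h : List.Forall₂ (program.Derivable n) t.prems ys) : program.Derivable n t.pred x := by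
  obtain ⟨hlen, hget⟩ := List.forall₂_iff_get.1 h
  refine .rule t x (fun s => ys[s.val]?.getD 0) ((program_cons_iff _ _ _ t).2 ⟨h1, h2⟩)
    (fun s hs => ?_) fun s q hq => ?_
  · have := List.getElem?_eq_none_iff.1 hs
    simp [List.getElem?_eq_none_iff.2 (hlen ▸ this)]
  · obtain ⟨hs, rfl⟩ := List.getElem?_eq_some_iff.1 hq
    simpa [List.getElem?_eq_getElem (hlen ▸ hs)] using hget s.val hs (hlen ▸ hs)

/-- What the predicates mean. -/
def Holds (n : ℕ) : Pred → (Fin 3 → ℕ) → Prop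
  | .sq, x => x 1 = x 0 * x 0
  | .pair, x => x 2 = Nat.pair (x 0) (x 1)
  | .ev, x => ∀ c : Code, Encodable.encode c = x 0 → x 2 ∈ c.eval (x 1)
  | .goal, _ => ∀ c : Code, Encodable.encode c = n → (c.eval 0).Dom

/-! ### Numbering and evaluation of codes. -/

theorem encode_pair (f g : Code) :
    Encodable.encode (f.pair g) = 4 * Nat.pair (Encodable.encode f) (Encodable.encode g) + 4 := by
  simp only [Code.encodeCode_eq, Code.encodeCode]
  ring

theorem encode_comp (f g : Code) :
    Encodable.encode (f.comp g) = 4 * Nat.pair (Encodable.encode f) (Encodable.encode g) + 6 := by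
  simp only [Code.encodeCode_eq, Code.encodeCode]
  ring

theorem encode_prec (f g : Code) :
    Encodable.encode (f.prec g) = 4 * Nat.pair (Encodable.encode f) (Encodable.encode g) + 5 := by
  simp only [Code.encodeCode_eq, Code.encodeCode]
  ring

theorem encode_rfind' (f : Code) :
    Encodable.encode f.rfind' = 4 * Encodable.encode f + 7 := by
  simp only [Code.encodeCode_eq, Code.encodeCode]
  ring

/-- `Holds` speaks of `ev` facts through codes with a given number. Since every number is the number
of a code, such a fact is never vacuous and can be used as a premise. -/
theorem exists_encode_eq (n : ℕ) : ∃ c : Code, Encodable.encode c = n :=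
  ⟨Denumerable.ofNat Code n, Denumerable.encode_ofNat n⟩

theorem mem_eval_prec_zero {f g : Code} {a b : ℕ} :
    b ∈ (f.prec g).eval (Nat.pair a 0) ↔ b ∈ f.eval a := by
  rw [Code.eval_prec_zero]

theorem mem_eval_prec_succ {f g : Code} {a k b : ℕ} :
    b ∈ (f.prec g).eval (Nat.pair a (k + 1)) ↔
      ∃ i ∈ (f.prec g).eval (Nat.pair a k), b ∈ g.eval (Nat.pair a (Nat.pair k i)) := by
  rw [← Nat.succ_eq_add_one, Code.eval_prec_succ]
  simp

/-- `rfind'` searches upwards from `m` and returns the position `m + k` of the zero, not the offset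
`k`. All earlier values must exist and be positive. -/
theorem mem_eval_rfind' {f : Code} {a m b : ℕ} :
    b ∈ f.rfind'.eval (Nat.pair a m) ↔ ∃ k, b = m + k ∧ 0 ∈ f.eval (Nat.pair a (m + k)) ∧
      ∀ i < k, ∃ z, z + 1 ∈ f.eval (Nat.pair a (m + i)) := by
  have h : ∀ k, k ∈ Nat.rfind (fun n => (fun m => decide (m = 0)) <$> f.eval (Nat.pair a (n + m))) ↔
      0 ∈ f.eval (Nat.pair a (m + k)) ∧ ∀ i < k, ∃ z, z + 1 ∈ f.eval (Nat.pair a (m + i)) := by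
    intro k
    refine Nat.mem_rfind.trans ?_
    refine and_congr ?_ (forall_congr' fun i => imp_congr Iff.rfl ?_)
    · refine (Part.mem_map_iff _).trans ?_
      rw [add_comm]
      simp
    · refine (Part.mem_map_iff _).trans ?_
      rw [add_comm]
      constructor
      · rintro ⟨w, hw, hw0⟩
        obtain ⟨z, rfl⟩ := Nat.exists_eq_succ_of_ne_zero (show w ≠ 0 by simpa using hw0)
        exact ⟨z, hw⟩
      · rintro ⟨z, hz⟩
        exact ⟨z + 1, hz, by simp⟩
  have h' : f.rfind'.eval (Nat.pair a m) = (Nat.rfind fun n =>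
      (fun m => decide (m = 0)) <$> f.eval (Nat.pair a (n + m))).map (· + m) := by
    simp [Code.eval, Nat.unpaired]
  rw [h', Part.mem_map_iff]
  constructor
  · rintro ⟨k, hk, rfl⟩
    exact ⟨k, add_comm _ _, (h k).1 hk⟩
  · rintro ⟨k, rfl, hk⟩
    exact ⟨k, (h k).2 hk, add_comm _ _⟩

theorem mem_eval_rfind'_of_zero {f : Code} {a m : ℕ} (h : 0 ∈ f.eval (Nat.pair a m)) :
    m ∈ f.rfind'.eval (Nat.pair a m) :=
  mem_eval_rfind'.2 ⟨0, rfl, h, fun _ hi => absurd hi (Nat.not_lt_zero _)⟩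

theorem mem_eval_rfind'_of_succ {f : Code} {a m z b : ℕ} (h : z + 1 ∈ f.eval (Nat.pair a m))
    (hb : b ∈ f.rfind'.eval (Nat.pair a (m + 1))) : b ∈ f.rfind'.eval (Nat.pair a m) := by
  obtain ⟨k, rfl, h0, hk⟩ := mem_eval_rfind'.1 hb
  refine mem_eval_rfind'.2 ⟨k + 1, by ring, by rwa [show m + (k + 1) = m + 1 + k by ring], ?_⟩
  rintro (_ | i) hi
  · exact ⟨z, h⟩
  · obtain ⟨w, hw⟩ := hk i (by omega)
    exact ⟨w, by rwa [show m + (i + 1) = m + 1 + i by ring]⟩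

theorem mem_eval_pair {f g : Code} {a b : ℕ} :
    b ∈ (f.pair g).eval a ↔ ∃ x ∈ f.eval a, ∃ y ∈ g.eval a, b = Nat.pair x y := by
  have h : (f.pair g).eval a
      = ((f.eval a).map Nat.pair).bind fun h => (g.eval a).map h := rfl
  rw [h, Part.mem_bind_iff]
  simp only [Part.mem_map_iff]
  constructor
  · rintro ⟨_, ⟨x, hx, rfl⟩, y, hy, rfl⟩
    exact ⟨x, hx, y, hy, rfl⟩
  · rintro ⟨x, hx, y, hy, rfl⟩
    exact ⟨_, ⟨x, hx, rfl⟩, y, hy, rfl⟩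

theorem mem_eval_comp {f g : Code} {a b : ℕ} :
    b ∈ (f.comp g).eval a ↔ ∃ x ∈ g.eval a, b ∈ f.eval x :=
  Part.mem_bind_iff

/-! ### Completeness: true facts are derivable. -/

theorem derivable_sq (n a : ℕ) : program.Derivable n .sq ![a, a * a, 0] := by
  induction a with
  | zero =>
    exact derivable_of_rule .sqZero _ [] (by simp [Rule.ges])
      (by simp [Rule.eqs, linEval, RuleVar.val]) .nil
  | succ a ih =>
    refine derivable_of_rule .sqSucc _ [_] (by simp [Rule.ges]) ?_ (.cons ih .nil)
    simp [Rule.eqs, linEval, RuleVar.val]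
    ring

theorem derivable_pair (n a b : ℕ) : program.Derivable n .pair ![a, b, Nat.pair a b] := by
  unfold Nat.pair
  split_ifs with h
  · refine derivable_of_rule .pairLt _ [_] ?_ ?_ (.cons (derivable_sq n b) .nil)
    · simp [Rule.ges, linEval, RuleVar.val]
      omega
    · simp [Rule.eqs, linEval, RuleVar.val]
  · refine derivable_of_rule .pairGe _ [_] ?_ ?_ (.cons (derivable_sq n a) .nil)
    · simp [Rule.ges, linEval, RuleVar.val]
      omega
    · simp [Rule.eqs, linEval, RuleVar.val]

/-- Induction on the code, with an inner induction on the recursion counter for `prec` and on the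
number of failed tests for `rfind'`. The premises follow the order in `Rule.prems`. -/
theorem derivable_of_mem_eval (n : ℕ) (c : Code) (a b : ℕ) (h : b ∈ c.eval a) :
    program.Derivable n .ev ![Encodable.encode c, a, b] := by
  induction c generalizing a b with
  | zero =>
    obtain rfl : b = 0 := Part.mem_some_iff.1 h
    exact derivable_of_rule .evZero _ [] (by simp [Rule.ges])
      (by simp [Rule.eqs, linEval, RuleVar.val, Code.encodeCode_eq, Code.encodeCode]) .nil
  | succ =>
    obtain rfl : b = a + 1 := Part.mem_some_iff.1 h
    exact derivable_of_rule .evSucc _ [] (by simp [Rule.ges])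
      (by simp [Rule.eqs, linEval, RuleVar.val, Code.encodeCode_eq, Code.encodeCode]) .nil
  | left =>
    obtain rfl : b = a.unpair.1 := Part.mem_some_iff.1 h
    exact derivable_of_rule .evLeft _ [_] (by simp [Rule.ges])
      (by simp [Rule.eqs, linEval, RuleVar.val, Code.encodeCode_eq, Code.encodeCode])
      (.cons (derivable_pair n a.unpair.1 a.unpair.2) .nil)
  | right =>
    obtain rfl : b = a.unpair.2 := Part.mem_some_iff.1 h
    exact derivable_of_rule .evRight _ [_] (by simp [Rule.ges])
      (by simp [Rule.eqs, linEval, RuleVar.val, Code.encodeCode_eq, Code.encodeCode])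
      (.cons (derivable_pair n a.unpair.1 a.unpair.2) .nil)
  | pair f g ihf ihg =>
    obtain ⟨x, hx, y, hy, rfl⟩ := mem_eval_pair.1 h
    exact derivable_of_rule .evPair _ [_, _, _, _] (by simp [Rule.ges])
      (by simp [Rule.eqs, linEval, RuleVar.val, encode_pair])
      (.cons (derivable_pair n (Encodable.encode f) (Encodable.encode g)) (.cons (ihf a x hx)
        (.cons (ihg a y hy) (.cons (derivable_pair n x y) .nil))))
  | comp f g ihf ihg =>
    obtain ⟨x, hx, hb⟩ := mem_eval_comp.1 h
    exact derivable_of_rule .evComp _ [_, _, _] (by simp [Rule.ges])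
      (by simp [Rule.eqs, linEval, RuleVar.val, encode_comp])
      (.cons (derivable_pair n (Encodable.encode f) (Encodable.encode g)) (.cons (ihg a x hx)
        (.cons (ihf x b hb) .nil)))
  | prec f g ihf ihg =>
    obtain ⟨x, k, rfl⟩ : ∃ x k, a = Nat.pair x k := ⟨_, _, (Nat.pair_unpair a).symm⟩
    induction k generalizing b with
    | zero =>
      exact derivable_of_rule .evPrecZero _ [_, _, _] (by simp [Rule.ges])
        (by simp [Rule.eqs, linEval, RuleVar.val, encode_prec])
        (.cons (derivable_pair n (Encodable.encode f) (Encodable.encode g))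
          (.cons (derivable_pair n x 0) (.cons (ihf x b (mem_eval_prec_zero.1 h)) .nil)))
    | succ k ih =>
      obtain ⟨i, hi, hb⟩ := mem_eval_prec_succ.1 h
      exact derivable_of_rule .evPrecSucc _ [_, _, _, _, _, _, _] (by simp [Rule.ges])
        (by simp [Rule.eqs, linEval, RuleVar.val, encode_prec])
        (.cons (derivable_pair n (Encodable.encode f) (Encodable.encode g))
          (.cons (derivable_pair n x (k + 1)) (.cons (derivable_pair n x k) (.cons (ih i hi)
            (.cons (derivable_pair n k i) (.cons (derivable_pair n x (Nat.pair k i))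
              (.cons (ihg _ b hb) .nil)))))))
  | rfind' f ih =>
    obtain ⟨x, m, rfl⟩ : ∃ x k, a = Nat.pair x k := ⟨_, _, (Nat.pair_unpair a).symm⟩
    obtain ⟨k, hk, h0, h⟩ := mem_eval_rfind'.1 h
    -- A search from `m` with `k + 1` failed tests is one failed test followed by a search from `m +
    -- 1` with `k` of them.
    induction k generalizing m with
    | zero =>
      rw [hk]
      exact derivable_of_rule .evFindZero _ [_, _] (by simp [Rule.ges])
        (by simp [Rule.eqs, linEval, RuleVar.val, encode_rfind'])
        (.cons (derivable_pair n x m) (.cons (ih _ _ h0) .nil))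
    | succ k ihk =>
      obtain ⟨z, hz⟩ := h 0 k.succ_pos
      have hr : m + (k + 1) = m + 1 + k := by ring
      rw [hr] at hk h0
      have h' : ∀ i < k, ∃ z, z + 1 ∈ f.eval (Nat.pair x (m + 1 + i)) := fun i hi => by
        have := h (i + 1) (by omega)
        rwa [show m + (i + 1) = m + 1 + i by ring] at this
      have hm := ihk (m + 1) (mem_eval_rfind'.2 ⟨k, hk, h0, h'⟩) hk h0 h'
      exact derivable_of_rule .evFindSucc _ [_, _, _, _]
        (by simp [Rule.ges, linEval, RuleVar.val])
        (by simp [Rule.eqs, linEval, RuleVar.val, encode_rfind'])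
        (.cons (derivable_pair n x m) (.cons (ih _ _ hz) (.cons (derivable_pair n x (m + 1))
          (.cons hm .nil))))

/-! ### Soundness: derivable facts are true. -/

theorem holds_of_derivable {n : ℕ} {q : Pred} {x : Fin 3 → ℕ} (h : program.Derivable n q x) :
    Holds n q x := by
  induction h with
  | rule t x y hc _ _ ih =>
    obtain ⟨hge, heq⟩ := (program_cons_iff n x y t).1 hc
    have hinj {c d : Code} (hcd : Encodable.encode c = Encodable.encode d) : c = d :=
      Encodable.encode_injective hcd
    cases t <;> simp [Rule.eqs, Rule.ges, linEval, RuleVar.val] at hge heq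
    case sqZero =>
      change x 1 = x 0 * x 0
      rw [heq.1, heq.2]
    case sqSucc =>
      have h0 : y 0 1 = y 0 0 * y 0 0 := ih 0 _ rfl
      have hx0 : x 0 = y 0 0 + 1 := by omega
      have hx1 : x 1 = y 0 1 + 2 * y 0 0 + 1 := by omega
      change x 1 = x 0 * x 0
      rw [hx0, hx1, h0]
      ring
    case pairLt =>
      have h0 : y 0 1 = y 0 0 * y 0 0 := ih 0 _ rfl
      have hx1 : y 0 0 = x 1 := by omega
      rw [hx1] at h0
      change x 2 = Nat.pair (x 0) (x 1)
      rw [Nat.pair, if_pos (by omega), ← h0]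
      omega
    case pairGe =>
      have h0 : y 0 1 = y 0 0 * y 0 0 := ih 0 _ rfl
      have hx1 : y 0 0 = x 0 := by omega
      rw [hx1] at h0
      change x 2 = Nat.pair (x 0) (x 1)
      rw [Nat.pair, if_neg (by omega), ← h0]
      omega
    case evZero =>
      intro c hc
      obtain rfl : c = .zero := hinj (hc.trans heq.1)
      exact Part.mem_some_iff.2 heq.2
    case evSucc =>
      intro c hc
      obtain rfl : c = .succ := hinj (hc.trans (show x 0 = 1 by omega))
      exact Part.mem_some_iff.2 (show x 2 = x 1 + 1 by omega)
    case evLeft =>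
      intro c hc
      have h0 : y 0 2 = Nat.pair (y 0 0) (y 0 1) := ih 0 _ rfl
      obtain rfl : c = .left := hinj (hc.trans (show x 0 = 2 by omega))
      refine Part.mem_some_iff.2 (show x 2 = (x 1).unpair.1 from ?_)
      rw [show x 1 = y 0 2 by omega, h0, Nat.unpair_pair]
      omega
    case evRight =>
      intro c hc
      have h0 : y 0 2 = Nat.pair (y 0 0) (y 0 1) := ih 0 _ rfl
      obtain rfl : c = .right := hinj (hc.trans (show x 0 = 3 by omega))
      refine Part.mem_some_iff.2 (show x 2 = (x 1).unpair.2 from ?_)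
      rw [show x 1 = y 0 2 by omega, h0, Nat.unpair_pair]
      omega
    case evPair =>
      intro c hc
      have h0 : y 0 2 = Nat.pair (y 0 0) (y 0 1) := ih 0 _ rfl
      have h1 : Holds n .ev (y 1) := ih 1 _ rfl
      have h2 : Holds n .ev (y 2) := ih 2 _ rfl
      have h3 : y 3 2 = Nat.pair (y 3 0) (y 3 1) := ih 3 _ rfl
      -- The subcodes occur only as numbers in a premise. Decoding them and using injectivity of the
      -- encoding identifies `c`; the other compound codes are treated alike.
      obtain ⟨f, hf⟩ := exists_encode_eq (y 0 0)
      obtain ⟨g, hg⟩ := exists_encode_eq (y 0 1)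
      obtain rfl : c = f.pair g := hinj (by rw [hc, encode_pair, hf, hg]; omega)
      have h1 := h1 f (by omega)
      have h2 := h2 g (by omega)
      rw [show y 1 1 = x 1 by omega] at h1
      rw [show y 2 1 = x 1 by omega] at h2
      refine mem_eval_pair.2 ⟨_, h1, _, h2, ?_⟩
      rw [show y 1 2 = y 3 0 by omega, show y 2 2 = y 3 1 by omega]
      omega
    case evComp =>
      intro c hc
      have h0 : y 0 2 = Nat.pair (y 0 0) (y 0 1) := ih 0 _ rfl
      have h1 : Holds n .ev (y 1) := ih 1 _ rfl
      have h2 : Holds n .ev (y 2) := ih 2 _ rfl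
      obtain ⟨f, hf⟩ := exists_encode_eq (y 0 0)
      obtain ⟨g, hg⟩ := exists_encode_eq (y 0 1)
      obtain rfl : c = f.comp g := hinj (by rw [hc, encode_comp, hf, hg]; omega)
      have h1 := h1 g (by omega)
      have h2 := h2 f (by omega)
      rw [show y 1 1 = x 1 by omega] at h1
      rw [show y 2 1 = y 1 2 by omega, show y 2 2 = x 2 by omega] at h2
      exact mem_eval_comp.2 ⟨_, h1, h2⟩
    case evPrecZero =>
      intro c hc
      have h0 : y 0 2 = Nat.pair (y 0 0) (y 0 1) := ih 0 _ rfl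
      have h1 : y 1 2 = Nat.pair (y 1 0) (y 1 1) := ih 1 _ rfl
      have h2 : Holds n .ev (y 2) := ih 2 _ rfl
      obtain ⟨f, hf⟩ := exists_encode_eq (y 0 0)
      obtain ⟨g, hg⟩ := exists_encode_eq (y 0 1)
      obtain rfl : c = f.prec g := hinj (by rw [hc, encode_prec, hf, hg]; omega)
      have h2 := h2 f (by omega)
      rw [show y 2 1 = y 1 0 by omega, show y 2 2 = x 2 by omega] at h2
      rw [show x 1 = y 1 2 by omega, h1, show y 1 1 = 0 by omega]
      exact mem_eval_prec_zero.2 h2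
    case evPrecSucc =>
      intro c hc
      have h0 : y 0 2 = Nat.pair (y 0 0) (y 0 1) := ih 0 _ rfl
      have h1 : y 1 2 = Nat.pair (y 1 0) (y 1 1) := ih 1 _ rfl
      have h2 : y 2 2 = Nat.pair (y 2 0) (y 2 1) := ih 2 _ rfl
      have h3 : Holds n .ev (y 3) := ih 3 _ rfl
      have h4 : y 4 2 = Nat.pair (y 4 0) (y 4 1) := ih 4 _ rfl
      have h5 : y 5 2 = Nat.pair (y 5 0) (y 5 1) := ih 5 _ rfl
      have h6 : Holds n .ev (y 6) := ih 6 _ rfl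
      obtain ⟨f, hf⟩ := exists_encode_eq (y 0 0)
      obtain ⟨g, hg⟩ := exists_encode_eq (y 0 1)
      obtain rfl : c = f.prec g := hinj (by rw [hc, encode_prec, hf, hg]; omega)
      have h3 := h3 (f.prec g) (by omega)
      have h6 := h6 g (by omega)
      rw [show y 3 1 = y 2 2 by omega, h2, show y 2 0 = y 1 0 by omega] at h3
      rw [show y 6 1 = y 5 2 by omega, show y 6 2 = x 2 by omega, h5, show y 5 1 = y 4 2 by omega,
        h4, show y 5 0 = y 1 0 by omega, show y 4 0 = y 2 1 by omega,
        show y 4 1 = y 3 2 by omega] at h6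
      rw [show x 1 = y 1 2 by omega, h1, show y 1 1 = y 2 1 + 1 by omega]
      exact mem_eval_prec_succ.2 ⟨_, h3, h6⟩
    case evFindZero =>
      intro c hc
      have h0 : y 0 2 = Nat.pair (y 0 0) (y 0 1) := ih 0 _ rfl
      have h1 : Holds n .ev (y 1) := ih 1 _ rfl
      obtain ⟨f, hf⟩ := exists_encode_eq (y 1 0)
      obtain rfl : c = f.rfind' := hinj (by rw [hc, encode_rfind', hf]; omega)
      have h1 := h1 f hf
      rw [show y 1 1 = y 0 2 by omega, show y 1 2 = 0 by omega, h0] at h1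
      rw [show x 1 = y 0 2 by omega, h0, show x 2 = y 0 1 by omega]
      exact mem_eval_rfind'_of_zero h1
    case evFindSucc =>
      intro c hc
      have h0 : y 0 2 = Nat.pair (y 0 0) (y 0 1) := ih 0 _ rfl
      have h1 : Holds n .ev (y 1) := ih 1 _ rfl
      have h2 : y 2 2 = Nat.pair (y 2 0) (y 2 1) := ih 2 _ rfl
      have h3 : Holds n .ev (y 3) := ih 3 _ rfl
      obtain ⟨f, hf⟩ := exists_encode_eq (y 1 0)
      obtain rfl : c = f.rfind' := hinj (by rw [hc, encode_rfind', hf]; omega)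
      have h1 := h1 f hf
      have h3 := h3 f.rfind' (by omega)
      -- The inequality attached to this rule makes the tested value positive, hence a successor.
      rw [show y 1 1 = y 0 2 by omega, h0, show y 1 2 = y 1 2 - 1 + 1 by omega] at h1
      rw [show y 3 1 = y 2 2 by omega, h2, show y 2 0 = y 0 0 by omega,
        show y 2 1 = y 0 1 + 1 by omega, show y 3 2 = x 2 by omega] at h3
      rw [show x 1 = y 0 2 by omega, h0]
      exact mem_eval_rfind'_of_succ h1 h3
    case halt =>
      intro c hc
      have h0 : Holds n .ev (y 0) := ih 0 _ rfl
      have h0 := h0 c (by omega)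
      rw [show y 0 1 = 0 by omega] at h0
      exact Part.dom_iff_mem.2 ⟨_, h0⟩

theorem derivable_goal_iff (c : Code) :
    (∃ x, program.Derivable (Encodable.encode c) program.goal x) ↔ (c.eval 0).Dom := by
  constructor
  · rintro ⟨x, hx⟩
    exact holds_of_derivable hx c rfl
  · intro h
    refine ⟨0, derivable_of_rule .halt _ [_] (by simp [Rule.ges]) ?_
      (.cons (derivable_of_mem_eval _ c 0 _ (Part.get_mem h)) .nil)⟩
    simp [Rule.eqs, linEval, RuleVar.val]

end CodeInterpreter

/-- Universal satisfiability of local (bidirectional) ReLU GNNs is undecidable: no computable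
predicate on descriptions is correct on the descriptions of all local ReLU GNNs. -/
theorem mainTheorem10 :
    ¬ ∃ P : GNN.Code → Prop, ComputablePred P ∧
      ∀ A : GNN, A.IsLocal → A.IsReLU → (P A.code ↔ A.UniversallySatisfiable) := by
  rintro ⟨P, hP, h⟩
  obtain ⟨A, hlocal, hrelu, hcode, hsat⟩ := CodeInterpreter.program.exists_networks
  refine ComputablePred.halting_problem 0 (ComputablePred.computable_of_manyOneReducible
    ⟨fun c => (A (Encodable.encode c)).code, hcode.comp Computable.encode, fun c => ?_⟩ hP)
  rw [h _ (hlocal _) (hrelu _), hsat, CodeInterpreter.derivable_goal_iff]
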